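/- Let $n\ge 1$, let $\mathcal{C}l_n$ be the real Clifford algebra generated by $e_1,\dots,e_n$ with $x^2=-\|x\|^2$ for $x\in\mathbb{R}^n$, with the norm $\|a\|^2=\sum_A a_A^2$ for $a=\sum_A a_Ae_A$. Identify $x=(x_0,\dots,x_n)\in\mathbb{R}^{n+1}$ with $x_0+\sum_{j=1}^n x_je_j\in\mathcal{C}l_n$, and put $\bar x=x_0-\sum_{j=1}^n x_je_j$. On the unit sphere $\mathbb{S}^n\subset\mathbb{R}^{n+1}$, with surface measure $dv$, let $$\Gamma_0=\sum_{j=1}^n e_j(x_0\partial_{x_j}-x_j\partial_{x_0})-\sum_{1\le i<j\le n}e_ie_j(x_i\partial_{x_j}-x_j\partial_{x_i}),\qquad \overline{\Gamma_0}=-\sum_{j=1}^n e_j(x_0\partial_{x_j}-x_j\partial_{x_0})-\sum_{1\le i<j\le n}e_ie_j(x_i\partial_{x_j}-x_j\partial_{x_i}),$$ $$D_s=w\Big(\Gamma_0-\frac n2\Big),\qquad \overline{D_s}=\overline w\Big(\overline{\Gamma_0}-\frac n2\Big)\qquad(w\in\mathbb{S}^n).$$ Let $\Omega\subseteq\mathbb{S}^n$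 be open, let $1<p<\infty$, and let $$Th(w)=\int_\Omega G_s(w-v)h(v)\,dv,\qquad G_s(w-v)=\frac{1}{\sigma_{n-1}}\,\frac{\overline{w-v}}{\|w-v\|^{n}},$$ where $\sigma_{n-1}$ is the area of the unit sphere of $\mathbb{R}^n$ (so that $D_sG_s=\delta$). Put $\Pi_{s,0}=(\overline{D_s}+\overline w)T$ and $\Pi_{s,1}=\overline{D_s}T$, where $D_s$ and $\overline{D_s}$ are applied on $\Omega$ in the sense of distributions, and let $\|\Pi_{s,i}\|\in[0,\infty]$ be the operator norm of $\Pi_{s,i}$ on $L^p(\Omega,\mathcal{C}l_n)$ (it is $\infty$ if $\Pi_{s,i}$ is not a bounded operator defined on all of $L^p(\Omega,\mathcal{C}l_n)$). Let $q:\Omega\to\mathcal{C}l_n$ be measurable, and let $\|q\|$ be the essential supremum over $w\in\Omega$ of the operator norm of the left multiplication $a\mapsto q(w)a$ on $\mathcal{C}l_n$. Let $\varphi:\Omega\to\mathcal{C}l_n$ be left monogenic, that is, of class $C^1$ with $D_s\varphi=0$ on $\Omega$. Let $q_0\ge 0$ be a constant with $\|q\|\le q_0$. 1. Suppose that $q_0<1/\|\Pi_{s,0}\|$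 and $(\overline{D_s}+\overline w)\varphi\in L^p(\Omega,\mathcal{C}l_n)$. Then the equation $$h=q\big((\overline{D_s}+\overline w)\varphi+\Pi_{s,0}h\big)$$ has a unique solution $h\in L^p(\Omega,\mathcal{C}l_n)$, and $f=\varphi+Th$ is a (distributional) solution of the spherical Beltrami equation $$D_sf=q(\overline{D_s}+\overline w)f\quad\text{on }\Omega.$$ It is the only one among the functions $\varphi+Th'$ with $h'\in L^p(\Omega,\mathcal{C}l_n)$: if $\varphi+Th'$ solves the Beltrami equation, then $h'=h$ almost everywhere. 2. Suppose that $q_0<1/\|\Pi_{s,1}\|$ and $\overline{D_s}\varphi\in L^p(\Omega,\mathcal{C}l_n)$. Then the equation $$h=q\big(\overline{D_s}\varphi+\Pi_{s,1}h\big)$$ has a unique solution $h\in L^p(\Omega,\mathcal{C}l_n)$, and $f=\varphi+Th$ is a (distributional) solution of $$D_sf=q\,\overline{D_s}f\quad\text{on }\Omega,$$ the only one among the functions $\varphi+Th'$ with $h'\in L^p(\Omega,\mathcal{C}l_n)$, in the same sense. -/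

import Mathlib

open MeasureTheory Set
open scoped ENNReal NNReal ContDiff

noncomputable section

namespace SphBeltrami

/-! ### The Clifford algebra and its norm -/

/-- The negative definite form `x ↦ -(x₁² + ⋯ + xₙ²)` on `ℝⁿ`. -/
def negForm (n : ℕ) : QuadraticForm ℝ (Fin n → ℝ) :=
  QuadraticMap.weightedSumSquares ℝ (fun _ : Fin n => (-1 : ℝ))

/-- The real Clifford algebra `Cl_n`, in which `x² = -‖x‖²` for `x ∈ ℝⁿ`. -/
abbrev Cl (n : ℕ) : Type := CliffordAlgebra (negForm n)

/-- The generators `e₁, …, eₙ` (indexed from `0`) of `Cl_n`. -/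
def e {n : ℕ} (j : Fin n) : Cl n := CliffordAlgebra.ι (negForm n) (Pi.single j 1)

/-- The basis `(e_A)` of `Cl_n` over the subsets `A`; by `clBasis_apply` below, `e_A` is the
product of the `e_j`, `j ∈ A`, in increasing order. -/
def clBasis (n : ℕ) : Module.Basis (Finset (Fin n)) ℝ (Cl n) :=
  (Pi.basisFun ℝ (Fin n)).ExteriorAlgebra.map (CliffordAlgebra.equivExterior (negForm n)).symm

/-- The coefficients `(x_A)` of a Clifford number. -/
def coeffs (n : ℕ) : Cl n →ₗ[ℝ] EuclideanSpace ℝ (Finset (Fin n)) :=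
  (WithLp.linearEquiv 2 ℝ (Finset (Fin n) → ℝ)).symm.toLinearMap ∘ₗ
    (clBasis n).equivFun.toLinearMap

theorem coeffs_injective (n : ℕ) : Function.Injective (coeffs n) :=
  (WithLp.linearEquiv 2 ℝ (Finset (Fin n) → ℝ)).symm.injective.comp (clBasis n).equivFun.injective

/-- The norm `‖x‖² = ∑_A x_A²` on `Cl_n`. -/
instance instNormedAddCommGroupCl (n : ℕ) : NormedAddCommGroup (Cl n) :=
  NormedAddCommGroup.induced (Cl n) (EuclideanSpace ℝ (Finset (Fin n))) (coeffs n)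
    (coeffs_injective n)

instance instNormedSpaceCl (n : ℕ) : NormedSpace ℝ (Cl n) :=
  NormedSpace.induced ℝ (Cl n) (EuclideanSpace ℝ (Finset (Fin n))) (coeffs n)

instance instFiniteDimensionalCl (n : ℕ) : FiniteDimensional ℝ (Cl n) :=
  (clBasis n).finiteDimensional_of_finite

theorem norm_sq_eq {n : ℕ} (x : Cl n) : ‖x‖ ^ 2 = ∑ A, (clBasis n).repr x A ^ 2 := by
  have h : ‖x‖ = ‖coeffs n x‖ := rfl
  rw [h, EuclideanSpace.norm_sq_eq]
  simp [coeffs]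

theorem contract_prod_eq_zero {n : ℕ} (d : Module.Dual ℝ (Fin n → ℝ)) (l : List (Fin n))
    (h : ∀ i ∈ l, d (Pi.single i 1) = 0) :
    CliffordAlgebra.contractLeft d
      ((l.map fun i => CliffordAlgebra.ι (0 : QuadraticForm ℝ (Fin n → ℝ))
        (Pi.single i (1 : ℝ))).prod) = 0 := by
  induction l with
  | nil => simp
  | cons a l ih =>
    rw [List.map_cons, List.prod_cons, CliffordAlgebra.contractLeft_ι_mul,
      ih fun i hi => h i (List.mem_cons_of_mem _ hi), h a List.mem_cons_self]
    simp

theorem equivExterior_prod {n : ℕ} (l : List (Fin n)) (hl : l.Nodup) :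
    CliffordAlgebra.equivExterior (negForm n) ((l.map e).prod) =
      (l.map fun i => CliffordAlgebra.ι (0 : QuadraticForm ℝ (Fin n → ℝ))
        (Pi.single i (1 : ℝ))).prod := by
  induction l with
  | nil => exact CliffordAlgebra.changeForm_one CliffordAlgebra.changeForm.associated_neg_proof
  | cons a l ih =>
    rw [List.nodup_cons] at hl
    have ih' := ih hl.2
    have key := CliffordAlgebra.changeForm_ι_mul
      (CliffordAlgebra.changeForm.associated_neg_proof (Q := negForm n))
      (Pi.single a 1) ((l.map e).prod)
    change CliffordAlgebra.changeForm CliffordAlgebra.changeForm.associated_neg_proof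
      (l.map e).prod = _ at ih'
    rw [ih', contract_prod_eq_zero, sub_zero] at key
    · rw [List.map_cons, List.prod_cons, List.map_cons, List.prod_cons]
      exact key
    · intro i hi
      have hia : a ≠ i := fun hh => hl.1 (hh ▸ hi)
      simp only [QuadraticMap.associated_apply, negForm, neg_apply,
        QuadraticMap.weightedSumSquares_apply, Pi.add_apply, smul_eq_mul]
      have h2 : ∀ x : Fin n, (Pi.single a (1 : ℝ) : Fin n → ℝ) x *
          (Pi.single i (1 : ℝ) : Fin n → ℝ) x = 0 := by
        intro x
        by_cases hx : x = a
        · subst hx; simp [hia]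
        · simp [hx]
      have h3 : ∑ x : Fin n, (-1 : ℝ) * (((Pi.single a (1 : ℝ) : Fin n → ℝ) x
            + (Pi.single i (1 : ℝ) : Fin n → ℝ) x)
            * ((Pi.single a (1 : ℝ) : Fin n → ℝ) x + (Pi.single i (1 : ℝ) : Fin n → ℝ) x)) =
          (∑ x : Fin n, (-1 : ℝ) * ((Pi.single a (1 : ℝ) : Fin n → ℝ) x
            * (Pi.single a (1 : ℝ) : Fin n → ℝ) x)) +
          ∑ x : Fin n, (-1 : ℝ) * ((Pi.single i (1 : ℝ) : Fin n → ℝ) x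
            * (Pi.single i (1 : ℝ) : Fin n → ℝ) x) := by
        rw [← Finset.sum_add_distrib]
        refine Finset.sum_congr rfl fun x _ => ?_
        linear_combination (-2 : ℝ) * h2 x
      rw [h3]
      simp

theorem clBasis_apply {n : ℕ} (A : Finset (Fin n)) :
    clBasis n A = ((A.sort (· ≤ ·)).map e).prod := by
  rw [clBasis, Module.Basis.map_apply, LinearEquiv.symm_apply_eq,
    equivExterior_prod _ (A.sort_nodup _), ExteriorAlgebra.basis_apply_ofCard _ (rfl : A.card = _)]
  change ExteriorAlgebra.ιMulti ℝ A.card _ = _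
  rw [ExteriorAlgebra.ιMulti_apply,
    ← Finset.listMap_orderEmbOfFin_finRange A rfl, List.map_map, List.ofFn_eq_map]
  congr 1
  refine List.map_congr_left fun i _ => ?_
  simp [ExteriorAlgebra.ι]
  rfl

/-- `‖q‖` for a function `q : Ω → Cl_n` acting by left multiplication: the essential supremum over
`w ∈ Ω` of the operator norm of the map `a ↦ q(w) a` of `Cl_n`. -/
def multNorm {n : ℕ} {α : Type*} [MeasurableSpace α] (μ : Measure α) (q : α → Cl n) : ℝ≥0∞ :=
  essSup (fun w => ‖LinearMap.toContinuousLinearMap (LinearMap.mulLeft ℝ (q w))‖ₑ) μ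

/-! ### The sphere `Sⁿ ⊂ ℝⁿ⁺¹` -/

/-- Euclidean space `ℝⁿ⁺¹`, with coordinates `x₀, …, xₙ`. -/
abbrev E (n : ℕ) : Type := EuclideanSpace ℝ (Fin (n + 1))

/-- The unit sphere `Sⁿ`. -/
abbrev Sph (n : ℕ) : Type := Metric.sphere (0 : E n) 1

/-- The surface measure of `Sⁿ`. -/
def surf (n : ℕ) : Measure (Sph n) := (volume : Measure (E n)).toSphere

/-- The surface area of `Sⁿ⁻¹`, the unit sphere of `ℝⁿ`. -/
def area (n : ℕ) : ℝ := (volume : Measure (EuclideanSpace ℝ (Fin n))).toSphere.real univ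

/-- The identification of `ℝⁿ⁺¹` with the paravectors: `x ↦ x₀ + x₁ e₁ + ⋯ + xₙ eₙ`. -/
def par {n : ℕ} (x : E n) : Cl n :=
  algebraMap ℝ (Cl n) (x 0) + ∑ j : Fin n, x j.succ • e j

/-- The conjugate `x̄ = x₀ - x₁ e₁ - ⋯ - xₙ eₙ` of a paravector. -/
def parBar {n : ℕ} (x : E n) : Cl n := CliffordAlgebra.involute (par x)

section Classical

variable {n : ℕ} {V : Type*} [NormedAddCommGroup V] [NormedSpace ℝ V]

/-- The extension of a function on the sphere to `ℝⁿ⁺¹ \ {0}` that is constant along rays. -/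
def homExt (f : Sph n → V) (x : E n) : V :=
  if hx : x = 0 then 0
  else f ⟨‖x‖⁻¹ • x, by simp [norm_smul, hx]⟩

/-- `f` is of class `C^k` on the open subset `Ω` of the sphere: its extension that is constant along
rays is of class `C^k` on the open cone over `Ω`. -/
def CkOn (k : WithTop ℕ∞) (f : Sph n → V) (Ω : Set (Sph n)) : Prop :=
  ContDiffOn ℝ k (homExt f) {x : E n | ∃ w ∈ Ω, ∃ r : ℝ, 0 < r ∧ x = r • (w : E n)}

/-- The tangential derivative `x_a ∂_b f - x_b ∂_a f` on the sphere. -/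
def rotDeriv (a b : Fin (n + 1)) (f : Sph n → V) (w : Sph n) : V :=
  fderiv ℝ (homExt f) w
    ((w : E n) a • EuclideanSpace.single b 1 - (w : E n) b • EuclideanSpace.single a 1)

/-- `Γ₀ = ∑_j e₀ e_j (x₀∂_j - x_j∂₀) - ∑_{i<j} e_i e_j (x_i∂_j - x_j∂_i)`, with `e₀ = 1`. -/
def Gam (f : Sph n → Cl n) (w : Sph n) : Cl n :=
  ∑ j : Fin n, e j * rotDeriv 0 j.succ f w
    - ∑ i : Fin n, ∑ j ∈ Finset.Ioi i, e i * e j * rotDeriv i.succ j.succ f w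

/-- `Γ̄₀ = -∑_j e₀ e_j (x₀∂_j - x_j∂₀) - ∑_{i<j} e_i e_j (x_i∂_j - x_j∂_i)`. -/
def GamBar (f : Sph n → Cl n) (w : Sph n) : Cl n :=
  -∑ j : Fin n, e j * rotDeriv 0 j.succ f w
    - ∑ i : Fin n, ∑ j ∈ Finset.Ioi i, e i * e j * rotDeriv i.succ j.succ f w

/-- The spherical Dirac operator `D_s = w (Γ₀ - n/2)`. -/
def Ds (f : Sph n → Cl n) (w : Sph n) : Cl n :=
  par (w : E n) * (Gam f w - ((n : ℝ) / 2) • f w)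

/-- The conjugate spherical Dirac operator `D̄_s = w̄ (Γ̄₀ - n/2)`. -/
def DsBar (f : Sph n → Cl n) (w : Sph n) : Cl n :=
  parBar (w : E n) * (GamBar f w - ((n : ℝ) / 2) • f w)

/-- `φ` is left monogenic on `Ω`. -/
def LeftMonogenic (Ω : Set (Sph n)) (φ : Sph n → Cl n) : Prop :=
  CkOn 1 φ Ω ∧ ∀ w ∈ Ω, Ds φ w = 0

end Classical

section Weak

variable {n : ℕ}

/-- Real-valued smooth functions on the sphere with (compact) support in `Ω`. -/
def IsTest (Ω : Set (Sph n)) (ψ : Sph n → ℝ) : Prop :=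
  CkOn ∞ ψ univ ∧ tsupport ψ ⊆ Ω

/-- `Γ₀ u = g` on `Ω` in the sense of distributions. The fields `x_a∂_b - x_b∂_a` are divergence
free on the sphere, so the transpose of each of them is its negative. -/
def IsWeakGam (Ω : Set (Sph n)) (u g : Sph n → Cl n) : Prop :=
  LocallyIntegrableOn u Ω (surf n) ∧ LocallyIntegrableOn g Ω (surf n) ∧
    ∀ ψ : Sph n → ℝ, IsTest Ω ψ →
      ∫ w in Ω, ψ w • g w ∂surf n =
        -∫ w in Ω, Gam (fun v => algebraMap ℝ (Cl n) (ψ v)) w * u w ∂surf n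

/-- `Γ̄₀ u = g` on `Ω` in the sense of distributions. -/
def IsWeakGamBar (Ω : Set (Sph n)) (u g : Sph n → Cl n) : Prop :=
  LocallyIntegrableOn u Ω (surf n) ∧ LocallyIntegrableOn g Ω (surf n) ∧
    ∀ ψ : Sph n → ℝ, IsTest Ω ψ →
      ∫ w in Ω, ψ w • g w ∂surf n =
        -∫ w in Ω, GamBar (fun v => algebraMap ℝ (Cl n) (ψ v)) w * u w ∂surf n

/-- `D_s u = g` on `Ω` in the sense of distributions, where `D_s = w (Γ₀ - n/2)`. -/
def IsWeakDs (Ω : Set (Sph n)) (u g : Sph n → Cl n) : Prop :=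
  ∃ γ : Sph n → Cl n, IsWeakGam Ω u γ ∧
    g =ᵐ[(surf n).restrict Ω] fun w => par (w : E n) * (γ w - ((n : ℝ) / 2) • u w)

/-- `D̄_s u = g` on `Ω` in the sense of distributions, where `D̄_s = w̄ (Γ̄₀ - n/2)`. -/
def IsWeakDsBar (Ω : Set (Sph n)) (u g : Sph n → Cl n) : Prop :=
  ∃ γ : Sph n → Cl n, IsWeakGamBar Ω u γ ∧
    g =ᵐ[(surf n).restrict Ω] fun w => parBar (w : E n) * (γ w - ((n : ℝ) / 2) • u w)

/-- The fundamental solution `G_s(w - v)` of `D_s`, normalized so that `D_s G_s = δ`. -/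
def Gs (w v : Sph n) : Cl n :=
  (area n * ‖(w : E n) - (v : E n)‖ ^ n)⁻¹ • parBar ((w : E n) - (v : E n))

/-- The Cauchy transform `T f(w) = ∫_Ω G_s(w - v) f(v) dv`. -/
def T (Ω : Set (Sph n)) (f : Sph n → Cl n) (w : Sph n) : Cl n :=
  ∫ v in Ω, Gs w v * f v ∂surf n

/-- `Π_{s,0} h = g` on `Ω`, where `Π_{s,0} = (D̄_s + w̄) T`. -/
def IsPi0 (Ω : Set (Sph n)) (h g : Sph n → Cl n) : Prop :=
  ∃ k : Sph n → Cl n, IsWeakDsBar Ω (T Ω h) k ∧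
    g =ᵐ[(surf n).restrict Ω] fun w => k w + parBar (w : E n) * T Ω h w

/-- `Π_{s,1} h = g` on `Ω`, where `Π_{s,1} = D̄_s T`. -/
def IsPi1 (Ω : Set (Sph n)) (h g : Sph n → Cl n) : Prop :=
  IsWeakDsBar Ω (T Ω h) g

/-- The operator norm on `L^p(Ω, Cl_n)` of the operator with the graph `P`: the infimum of the `C`
such that every `h ∈ L^p` has an image `g ∈ L^p` with `‖g‖_p ≤ C ‖h‖_p` (so `∞` if the operator is
not everywhere defined or not bounded). -/
def piNorm (Ω : Set (Sph n)) (p : ℝ≥0∞) (P : (Sph n → Cl n) → (Sph n → Cl n) → Prop) : ℝ≥0∞ :=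
  sInf {C : ℝ≥0∞ | ∀ h : Sph n → Cl n, MemLp h p ((surf n).restrict Ω) →
    ∃ g : Sph n → Cl n, P h g ∧ MemLp g p ((surf n).restrict Ω) ∧
      eLpNorm g p ((surf n).restrict Ω) ≤ C * eLpNorm h p ((surf n).restrict Ω)}

/-- `f` is a (distributional) solution of `D_s f = q (D̄_s + w̄) f` on `Ω`. -/
def SolvesBeltrami0 (Ω : Set (Sph n)) (q f : Sph n → Cl n) : Prop :=
  ∃ g k : Sph n → Cl n, IsWeakDs Ω f g ∧ IsWeakDsBar Ω f k ∧
    g =ᵐ[(surf n).restrict Ω] fun w => q w * (k w + parBar (w : E n) * f w)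

/-- `f` is a (distributional) solution of `D_s f = q D̄_s f` on `Ω`. -/
def SolvesBeltrami1 (Ω : Set (Sph n)) (q f : Sph n → Cl n) : Prop :=
  ∃ g k : Sph n → Cl n, IsWeakDs Ω f g ∧ IsWeakDsBar Ω f k ∧
    g =ᵐ[(surf n).restrict Ω] fun w => q w * k w

/-- `h = q ((D̄_s + w̄) φ + Π_{s,0} h)` on `Ω`. -/
def SolvesIntegral0 (Ω : Set (Sph n)) (q φ h : Sph n → Cl n) : Prop :=
  ∃ g : Sph n → Cl n, IsPi0 Ω h g ∧
    h =ᵐ[(surf n).restrict Ω] fun w => q w * (DsBar φ w + parBar (w : E n) * φ w + g w)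

/-- `h = q (D̄_s φ + Π_{s,1} h)` on `Ω`. -/
def SolvesIntegral1 (Ω : Set (Sph n)) (q φ h : Sph n → Cl n) : Prop :=
  ∃ g : Sph n → Cl n, IsPi1 Ω h g ∧
    h =ᵐ[(surf n).restrict Ω] fun w => q w * (DsBar φ w + g w)

end Weak

end SphBeltrami

end

open SphBeltrami

noncomputable section
namespace SphBeltrami

/-! The whole theorem rests on one analytic fact: `D_s T h = h` in the sense of distributions for
every integrable `h` (`isWeakDs_T`). Since `φ` is monogenic, `D_s (φ + T h) = h`, while `(D̄_s +
m)(φ + T h) = (D̄_s + m) φ + Π h` with `Π = (D̄_s + m) T`. So the Beltrami equation for `φ + T h` is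
the same thing as the integral equation `h = q ((D̄_s + m) φ + Π h)` (`solvesBeltrami_iff`). When
`q₀ ‖Π‖ < 1` the right-hand side is a contraction of `L^p`, and Banach's fixed point theorem yields
existence and uniqueness (`exists_unique_integral_equation`). Both parts are one statement, with `m
= w̄` and with `m = 0`.

For `D_s T h = h` it suffices, by Fubini, to know `(Γ₀ - n/2) G_s(· - v) = v̄ δ_v`, because `w w̄ =
1`. The kernel is regularized by replacing `‖w - v‖` in the denominator by `R = √(‖w - v‖² + ε²)`. A
computation in the Clifford algebra gives exactly `(Γ₀ - n/2) G_ε = (K_ε / 2)(w̄ + v̄)` with `K_ε =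
n ε² / (σ R^(n+2))` (`Gam_gReg`); the constant `n/2` is what makes all other terms cancel. As `ε →
0`, `K_ε` is an approximate identity at `v` (`tendsto_integral_peakKer`), whereas `G_ε → G_s` under
the integrable bound `C ‖w - v‖^(-(n-1))`.

Operators are moved onto test functions by integration by parts, which holds because the fields `x_a
∂_b - x_b ∂_a` generate rotations and rotations preserve the surface measure (`integral_rotDeriv`).
All integrals with a pole at `v` are reduced to one variable, the angle from `v`
(`lintegral_zonal`). -/

/-! ### Integration of zonal functions over the sphere -/

/-- Polar coordinates for the lower integral. -/
theorem lintegral_eq_lintegral_toSphere {F : Type*} [NormedAddCommGroup F] [NormedSpace ℝ F]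
    [MeasurableSpace F] [BorelSpace F] [FiniteDimensional ℝ F] [Nontrivial F]
    (μ : Measure F) [μ.IsAddHaarMeasure] {f : F → ℝ≥0∞} (hf : Measurable f) :
    ∫⁻ x, f x ∂μ = ∫⁻ u, (∫⁻ r in Ioi (0 : ℝ),
      ENNReal.ofReal (r ^ (Module.finrank ℝ F - 1)) * f (r • (u : F))) ∂μ.toSphere := by
  have hmp := μ.measurePreserving_homeomorphUnitSphereProd.symm
    (homeomorphUnitSphereProd F).toMeasurableEquiv
  calc ∫⁻ x, f x ∂μ = ∫⁻ x in ({0}ᶜ : Set F), f x ∂μ := by rw [restrict_compl_singleton]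
    _ = ∫⁻ x : ({0}ᶜ : Set F), f x ∂(μ.comap (↑)) := by
        rw [lintegral_subtype_comap (measurableSet_singleton _).compl]
    _ = ∫⁻ p, f (((homeomorphUnitSphereProd F).toMeasurableEquiv.symm p : ({0}ᶜ : Set F)) : F)
          ∂(μ.toSphere.prod (Measure.volumeIoiPow (Module.finrank ℝ F - 1))) :=
        (hmp.lintegral_comp (hf.comp measurable_subtype_coe)).symm
    _ = _ := by
        rw [lintegral_prod]
        · refine lintegral_congr fun u => ?_
          rw [Measure.volumeIoiPow, lintegral_withDensity_eq_lintegral_mul]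
          · exact lintegral_subtype_comap measurableSet_Ioi
              (fun r => ENNReal.ofReal (r ^ (Module.finrank ℝ F - 1)) * f (r • (u : F)))
          · fun_prop
          · refine hf.comp (measurable_subtype_coe.comp ?_)
            exact (homeomorphUnitSphereProd F).toMeasurableEquiv.symm.measurable.comp
              measurable_prodMk_left
        · exact (hf.comp (measurable_subtype_coe.comp
            (homeomorphUnitSphereProd F).toMeasurableEquiv.symm.measurable)).aemeasurable

/-- The surface measure is invariant under linear isometries. -/
theorem measurePreserving_sphere {F : Type*} [NormedAddCommGroup F] [InnerProductSpace ℝ F]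
    [MeasurableSpace F] [BorelSpace F] [FiniteDimensional ℝ F] (A : F ≃ₗᵢ[ℝ] F)
    (g : Metric.sphere (0 : F) 1 → Metric.sphere (0 : F) 1)
    (hg : ∀ u, (g u : F) = A u) :
    MeasurePreserving g (volume : Measure F).toSphere (volume : Measure F).toSphere := by
  have hgc : Continuous g := by
    rw [continuous_induced_rng]
    have : (Subtype.val ∘ g) = fun u : Metric.sphere (0 : F) 1 => A u := funext hg
    rw [this]
    fun_prop
  refine ⟨hgc.measurable, Measure.ext fun s hs => ?_⟩
  -- Up to a dimensional factor, the surface measure of `s` is the volume of the truncated cone `(0,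
  -- 1) • s`, and `A` carries the cone over `g ⁻¹' s` onto the cone over `s`.
  rw [Measure.map_apply hgc.measurable hs, Measure.toSphere_apply' _ hs,
    Measure.toSphere_apply' _ (hgc.measurable hs)]
  congr 1
  conv_rhs => rw [← A.measurePreserving.measure_preimage_equiv (f := A.toMeasurableEquiv)]
  congr 1
  ext x
  simp only [mem_preimage, Set.mem_smul, mem_image]
  change _ ↔ ∃ r ∈ Ioo (0 : ℝ) 1, ∃ y, (∃ u ∈ s, (u : F) = y) ∧ r • y = A x
  constructor
  · rintro ⟨r, hr, _, ⟨u, hu, rfl⟩, rfl⟩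
    exact ⟨r, hr, _, ⟨g u, hu, rfl⟩, by simp [hg]⟩
  · rintro ⟨r, hr, _, ⟨u, hu, rfl⟩, h⟩
    refine ⟨r, hr, A.symm u, ⟨⟨A.symm u, by simp⟩, ?_, rfl⟩, ?_⟩
    · have : g ⟨A.symm u, by simp⟩ = u := Subtype.ext (by simp [hg])
      rwa [this]
    · rw [← map_smul, h, A.symm_apply_apply]

/-- Linear isometries act transitively on the sphere. -/
theorem exists_isometry_apply_eq {n : ℕ} (v : Sph n) :
    ∃ A : E n ≃ₗᵢ[ℝ] E n, A (EuclideanSpace.single 0 1) = v := by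
  have hv : ‖(v : E n)‖ = 1 := by simp
  obtain ⟨b, hb⟩ := Orthonormal.exists_orthonormalBasis_extension_of_card_eq (𝕜 := ℝ) (E := E n)
    (ι := Fin (n + 1)) (by simp) (v := fun _ => (v : E n)) (s := {0})
    ⟨fun i => by simp, fun i j hij => absurd (Subsingleton.elim i j) hij⟩
  refine ⟨b.repr.symm, ?_⟩
  rw [OrthonormalBasis.repr_symm_single]
  exact hb 0 rfl

/-- The point `(t, y)` of `ℝ × ℝⁿ = ℝⁿ⁺¹`. -/
def consE {n : ℕ} (t : ℝ) (y : EuclideanSpace ℝ (Fin n)) : E n :=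
  WithLp.toLp 2 (Fin.cons t y.ofLp : Fin (n + 1) → ℝ)

theorem consE_zero {n : ℕ} (t : ℝ) (y : EuclideanSpace ℝ (Fin n)) : consE t y 0 = t := rfl

theorem norm_consE {n : ℕ} (t : ℝ) (y : EuclideanSpace ℝ (Fin n)) :
    ‖consE t y‖ = √(t ^ 2 + ‖y‖ ^ 2) := by
  rw [EuclideanSpace.norm_eq, EuclideanSpace.norm_sq_eq, Fin.sum_univ_succ]
  simp [consE]

theorem lintegral_eq_lintegral_consE {n : ℕ} {f : E n → ℝ≥0∞} (hf : Measurable f) :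
    ∫⁻ x, f x = ∫⁻ t : ℝ, ∫⁻ y : EuclideanSpace ℝ (Fin n), f (consE t y) := by
  have h1 := PiLp.volume_preserving_toLp (Fin (n + 1))
  have h2 := (volume_preserving_piFinSuccAbove (fun _ : Fin (n + 1) => ℝ) 0).symm
  have h3 := PiLp.volume_preserving_ofLp (Fin n)
  have hg : Measurable fun p : ℝ × (Fin n → ℝ) =>
      f (WithLp.toLp 2 ((MeasurableEquiv.piFinSuccAbove (fun _ : Fin (n + 1) => ℝ) 0).symm p)) :=
    hf.comp (h1.measurable.comp (MeasurableEquiv.measurable _))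
  rw [← h1.lintegral_comp hf,
    ← h2.lintegral_comp (f := fun x => f (WithLp.toLp 2 x)) (hf.comp h1.measurable), Measure.volume_eq_prod,
    lintegral_prod _ hg.aemeasurable]
  refine lintegral_congr fun t => ?_
  have hcons : ∀ y : EuclideanSpace ℝ (Fin n), consE t y = WithLp.toLp 2
      ((MeasurableEquiv.piFinSuccAbove (fun _ : Fin (n + 1) => ℝ) 0).symm (t, y.ofLp)) := fun y =>
    congrArg (WithLp.toLp 2) (Fin.insertNth_zero' t y.ofLp).symm
  simp only [hcons]
  exact (h3.lintegral_comp (hg.comp (measurable_prodMk_left (x := t)))).symm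

/-- Integration over the sphere of a function of the latitude. -/
theorem lintegral_zonal_pole {n : ℕ} (hn : 1 ≤ n) {f : ℝ → ℝ≥0∞} (hf : Measurable f) :
    ∫⁻ w : Sph n, f ((w : E n) 0) ∂surf n =
      (volume : Measure (EuclideanSpace ℝ (Fin n))).toSphere univ *
        ∫⁻ θ in Ioo 0 Real.pi, ENNReal.ofReal (Real.sin θ ^ (n - 1)) * f (Real.cos θ) := by
  have : Nonempty (Fin n) := ⟨⟨0, hn⟩⟩
  -- The integral of `f (x₀ / ‖x‖)` over the unit ball is computed twice, in polar coordinates of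
  -- `ℝⁿ⁺¹` and after splitting off `x₀`. The cutoff keeps the common radial factor `c = 1 / (n +
  -- 1)` finite and nonzero, so that it cancels.
  set χ : ℝ → ℝ≥0∞ := (Iio 1).indicator 1 with hχ
  have hχm : Measurable χ := measurable_one.indicator measurableSet_Iio
  set c : ℝ≥0∞ := ∫⁻ r in Ioi (0 : ℝ), ENNReal.ofReal (r ^ n) * χ r with hc
  have hc' : c = ENNReal.ofReal (1 / (n + 1)) := by
    have : c = ∫⁻ r in Ioo (0 : ℝ) 1, ENNReal.ofReal (r ^ n) := by
      rw [hc, ← lintegral_indicator measurableSet_Ioi, ← lintegral_indicator measurableSet_Ioo]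
      refine lintegral_congr fun r => ?_
      by_cases h0 : 0 < r <;> by_cases h1 : r < 1 <;> simp [hχ, indicator, h0, h1]
    rw [this, Measure.restrict_congr_set Ioo_ae_eq_Ioc, ← ofReal_integral_eq_lintegral_ofReal,
      ← intervalIntegral.integral_of_le zero_le_one]
    · simp
    · exact (intervalIntegral.intervalIntegrable_pow n).1
    · filter_upwards [ae_restrict_mem measurableSet_Ioc] with y hy
      exact pow_nonneg hy.1.le _
  have hc0 : c ≠ 0 := by rw [hc']; simp; positivity
  have hct : c ≠ ⊤ := by rw [hc']; simp
  set F : E n → ℝ≥0∞ := fun x => f (x 0 / ‖x‖) * χ ‖x‖ with hF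
  have hFm : Measurable F := by fun_prop
  have hL : ∫⁻ x, F x = c * ∫⁻ w : Sph n, f ((w : E n) 0) ∂surf n := by
    rw [lintegral_eq_lintegral_toSphere _ hFm, ← lintegral_const_mul' _ _ hct]
    refine lintegral_congr fun u => ?_
    rw [hc, ← lintegral_mul_const _ (by fun_prop)]
    refine setLIntegral_congr_fun measurableSet_Ioi fun r (hr : 0 < r) => ?_
    have h1 : ‖r • (u : E n)‖ = r := by simp [norm_smul, abs_of_pos hr]
    have h2 : (r • (u : E n)) 0 / r = (u : E n) 0 := by simp [hr.ne']
    simp only [hF, h1, h2]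
    simp only [finrank_euclideanSpace, Fintype.card_fin, Nat.add_sub_cancel]
    ring
  have hR : ∫⁻ x, F x = c * ((volume : Measure (EuclideanSpace ℝ (Fin n))).toSphere univ *
        ∫⁻ θ in Ioo 0 Real.pi, ENNReal.ofReal (Real.sin θ ^ (n - 1)) * f (Real.cos θ)) := by
    rw [lintegral_eq_lintegral_consE hFm]
    set H : ℝ → ℝ → ℝ≥0∞ := fun t r =>
      ENNReal.ofReal (r ^ (n - 1)) * (f (t / √(t ^ 2 + r ^ 2)) * χ √(t ^ 2 + r ^ 2)) with hH
    have hHm : Measurable fun p : ℝ × ℝ => (Ioi (0 : ℝ)).indicator (H p.1) p.2 := by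
      have : (fun p : ℝ × ℝ => (Ioi (0 : ℝ)).indicator (H p.1) p.2) =
          (Prod.snd ⁻¹' Ioi (0 : ℝ)).indicator (fun p : ℝ × ℝ => H p.1 p.2) := by
        ext p; simp [indicator]
      rw [this]
      refine Measurable.indicator ?_ (measurable_snd measurableSet_Ioi)
      fun_prop
    have h1 : ∀ t : ℝ, ∫⁻ y : EuclideanSpace ℝ (Fin n), F (consE t y) =
        (volume : Measure (EuclideanSpace ℝ (Fin n))).toSphere univ *
          ∫⁻ r, (Ioi (0 : ℝ)).indicator (H t) r := by
      intro t
      simp only [hF, norm_consE, consE_zero]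
      rw [lintegral_eq_lintegral_toSphere _ (by fun_prop), lintegral_indicator measurableSet_Ioi,
        mul_comm, ← lintegral_const]
      refine lintegral_congr fun u => setLIntegral_congr_fun measurableSet_Ioi
        fun r (hr : 0 < r) => ?_
      have h1 : ‖r • (u : EuclideanSpace ℝ (Fin n))‖ = r := by simp [norm_smul, abs_of_pos hr]
      simp only [hH, h1, finrank_euclideanSpace, Fintype.card_fin]
    simp only [h1]
    rw [lintegral_const_mul' _ _ (measure_ne_top _ _), mul_left_comm]
    congr 1
    -- The pair `(t, ‖y‖)` ranges over a half-plane, which is `0 < θ < π` in plane polar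
    -- coordinates. The weight `‖y‖ ^ (n - 1)` and the Jacobian `r` combine to `r ^ n * sin θ ^ (n -
    -- 1)`.
    rw [← lintegral_prod (fun p : ℝ × ℝ => (Ioi (0 : ℝ)).indicator (H p.1) p.2) hHm.aemeasurable,
      ← Measure.volume_eq_prod, ← lintegral_comp_polarCoord_symm, polarCoord_target,
      Measure.volume_eq_prod, ← Measure.prod_restrict, lintegral_prod]
    · rw [hc, ← lintegral_mul_const _ (by fun_prop)]
      refine setLIntegral_congr_fun measurableSet_Ioi fun r (hr : 0 < r) => ?_
      rw [← lintegral_const_mul _ (by fun_prop), ← lintegral_indicator measurableSet_Ioo,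
        ← lintegral_indicator measurableSet_Ioo]
      refine lintegral_congr fun θ => ?_
      have hsq : √((r * Real.cos θ) ^ 2 + (r * Real.sin θ) ^ 2) = r := by
        rw [mul_pow, mul_pow, ← mul_add, Real.cos_sq_add_sin_sq, mul_one, Real.sqrt_sq hr.le]
      have hdiv : r * Real.cos θ / r = Real.cos θ := by field_simp
      by_cases hθ : θ ∈ Ioo 0 Real.pi
      · have hs : 0 < Real.sin θ := Real.sin_pos_of_mem_Ioo hθ
        have hmem : θ ∈ Ioo (-Real.pi) Real.pi := ⟨by linarith [hθ.1, Real.pi_pos], hθ.2⟩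
        rw [indicator_of_mem hθ, indicator_of_mem hmem]
        simp only [polarCoord_symm_apply]
        rw [indicator_of_mem (mem_Ioi.2 (mul_pos hr hs))]
        simp only [hH, hsq, hdiv, smul_eq_mul]
        rw [mul_pow, ENNReal.ofReal_mul (by positivity)]
        have : ENNReal.ofReal (r ^ n) = ENNReal.ofReal r * ENNReal.ofReal (r ^ (n - 1)) := by
          rw [← ENNReal.ofReal_mul hr.le, ← pow_succ', Nat.sub_add_cancel hn]
        rw [this]
        ring
      · rw [indicator_of_notMem hθ]
        by_cases hmem : θ ∈ Ioo (-Real.pi) Real.pi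
        · rw [indicator_of_mem hmem]
          simp only [polarCoord_symm_apply]
          rw [indicator_of_notMem, smul_zero]
          have : θ ≤ 0 := by
            by_contra h
            exact hθ ⟨not_le.1 h, hmem.2⟩
          have := Real.sin_nonpos_of_nonpos_of_neg_pi_le this hmem.1.le
          rw [mem_Ioi, not_lt]
          exact mul_nonpos_of_nonneg_of_nonpos hr.le this
        · rw [indicator_of_notMem hmem]
    · refine Measurable.aemeasurable (Measurable.mul (by fun_prop) (hHm.comp ?_))
      exact continuous_polarCoord_symm.measurable
  rw [hL] at hR
  exact (ENNReal.mul_right_inj hc0 hct).1 hR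

/-- Integration over the sphere of a zonal function. -/
theorem lintegral_zonal {n : ℕ} (hn : 1 ≤ n) (v : Sph n) {f : ℝ → ℝ≥0∞} (hf : Measurable f) :
    ∫⁻ w : Sph n, f (inner ℝ (w : E n) (v : E n)) ∂surf n =
      (volume : Measure (EuclideanSpace ℝ (Fin n))).toSphere univ *
        ∫⁻ θ in Ioo 0 Real.pi, ENNReal.ofReal (Real.sin θ ^ (n - 1)) * f (Real.cos θ) := by
  obtain ⟨A, hA⟩ := exists_isometry_apply_eq v
  have hmp := measurePreserving_sphere A (fun u => ⟨A u, by simp⟩) fun _ => rfl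
  rw [← lintegral_zonal_pole hn hf, surf, ← hmp.lintegral_comp]
  · refine lintegral_congr fun u => ?_
    rw [← hA]
    simp only [LinearIsometryEquiv.inner_map_map]
    simp [EuclideanSpace.inner_single_right]
  · exact hf.comp (by fun_prop)

/-! ### Integrability of the singularity and the approximate identity -/

open Filter Topology

theorem norm_sub_sq_sphere {n : ℕ} (w v : Sph n) :
    ‖(w : E n) - v‖ ^ 2 = 2 - 2 * inner ℝ (w : E n) (v : E n) := by
  rw [norm_sub_sq_real]
  simp
  ring

theorem inner_le_one_sphere {n : ℕ} (w v : Sph n) : inner ℝ (w : E n) (v : E n) ≤ 1 := by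
  have := norm_sub_sq_sphere w v
  nlinarith [sq_nonneg ‖(w : E n) - v‖]

theorem neg_one_le_inner_sphere {n : ℕ} (w v : Sph n) : -1 ≤ inner ℝ (w : E n) (v : E n) := by
  have := norm_add_sq_real (w : E n) (v : E n)
  simp at this
  nlinarith [sq_nonneg ‖(w : E n) + v‖]

theorem area_nonneg (n : ℕ) : 0 ≤ area n := ENNReal.toReal_nonneg

theorem area_pos {n : ℕ} (hn : 1 ≤ n) : 0 < area n := by
  have : Nonempty (Fin n) := ⟨⟨0, hn⟩⟩
  have : NeZero ((volume : Measure (EuclideanSpace ℝ (Fin n))).toSphere univ) :=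
    ⟨by rw [Ne, Measure.measure_univ_eq_zero]; exact Measure.toSphere_ne_zero _⟩
  exact ENNReal.toReal_pos this.out (measure_ne_top _ _)

instance (n : ℕ) : IsFiniteMeasure (surf n) := by unfold surf; infer_instance

theorem two_sub_two_cos (θ : ℝ) : 2 - 2 * Real.cos θ = (2 * Real.sin (θ / 2)) ^ 2 := by
  have h := Real.cos_sq' (θ / 2)
  have h2 := Real.cos_two_mul (θ / 2)
  rw [mul_div_cancel₀ θ two_ne_zero] at h2
  rw [h2]
  linear_combination (-4) * h

theorem one_add_cos_div_two (θ : ℝ) : (1 + Real.cos θ) / 2 = Real.cos (θ / 2) ^ 2 := by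
  have h2 := Real.cos_two_mul (θ / 2)
  rw [mul_div_cancel₀ θ two_ne_zero] at h2
  rw [h2]
  ring

theorem sin_eq_half (θ : ℝ) : Real.sin θ = 2 * Real.sin (θ / 2) * Real.cos (θ / 2) := by
  rw [← Real.sin_two_mul, mul_div_cancel₀ θ two_ne_zero]

/-- At angle `θ` from `v` the chord is `2 sin (θ/2)`, so the weight `sin θ ^ (n - 1)` cancels the
singularity and leaves `cos (θ/2) ^ (n - 1) ≤ 1`. The bound does not depend on `v`. -/
theorem lintegral_inv_pow_norm_sub_le {n : ℕ} (hn : 1 ≤ n) (v : Sph n) :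
    ∫⁻ w : Sph n, ENNReal.ofReal ((‖(w : E n) - v‖ ^ (n - 1))⁻¹) ∂surf n ≤
      ENNReal.ofReal (area n * Real.pi) := by
  have h := lintegral_zonal hn v (f := fun s => ENNReal.ofReal ((√(2 - 2 * s) ^ (n - 1))⁻¹))
    (by fun_prop)
  simp only [← norm_sub_sq_sphere, Real.sqrt_sq (norm_nonneg _)] at h
  rw [h, ENNReal.ofReal_mul (area_nonneg n), area, measureReal_def, ENNReal.ofReal_toReal (measure_ne_top _ _)]
  gcongr
  calc _ ≤ ∫⁻ θ in Ioo 0 Real.pi, 1 := by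
        refine setLIntegral_mono measurable_const fun θ hθ => ?_
        have hs : 0 < Real.sin (θ / 2) :=
          Real.sin_pos_of_mem_Ioo ⟨by linarith [hθ.1], by linarith [hθ.2, Real.pi_pos]⟩
        have hc : 0 < Real.cos (θ / 2) :=
          Real.cos_pos_of_mem_Ioo ⟨by linarith [hθ.1, Real.pi_pos], by linarith [hθ.2]⟩
        rw [two_sub_two_cos, Real.sqrt_sq (by positivity), sin_eq_half,
          ← ENNReal.ofReal_mul (by positivity), mul_pow (2 * _)]
        rw [mul_right_comm, mul_inv_cancel₀ (by positivity), one_mul]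
        exact ENNReal.ofReal_le_one.2 (pow_le_one₀ hc.le (Real.cos_le_one _))
    _ = ENNReal.ofReal Real.pi := by simp

theorem integrable_inv_pow_norm_sub {n : ℕ} (hn : 1 ≤ n) (v : Sph n) :
    Integrable (fun w : Sph n => (‖(w : E n) - v‖ ^ (n - 1))⁻¹) (surf n) := by
  refine ⟨by fun_prop, ?_⟩
  rw [hasFiniteIntegral_iff_ofReal (ae_of_all _ fun w => by positivity)]
  exact (lintegral_inv_pow_norm_sub_le hn v).trans_lt ENNReal.ofReal_lt_top

theorem integral_zonal {n : ℕ} (hn : 1 ≤ n) (v : Sph n) {f : ℝ → ℝ} (hf : Measurable f)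
    (h0 : ∀ s, |s| ≤ 1 → 0 ≤ f s) :
    ∫ w : Sph n, f (inner ℝ (w : E n) (v : E n)) ∂surf n =
      area n * ∫ θ in (0 : ℝ)..Real.pi, Real.sin θ ^ (n - 1) * f (Real.cos θ) := by
  rw [integral_eq_lintegral_of_nonneg_ae, lintegral_zonal hn v (f := fun s => ENNReal.ofReal (f s))
    (by fun_prop), ENNReal.toReal_mul, intervalIntegral.integral_of_le Real.pi_pos.le,
    integral_Ioc_eq_integral_Ioo, integral_eq_lintegral_of_nonneg_ae]
  · rw [area, measureReal_def]
    congr 2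
    refine setLIntegral_congr_fun measurableSet_Ioo fun θ hθ => ?_
    rw [ENNReal.ofReal_mul (pow_nonneg (Real.sin_pos_of_mem_Ioo hθ).le _)]
  · filter_upwards [ae_restrict_mem measurableSet_Ioo] with θ hθ
    exact mul_nonneg (pow_nonneg (Real.sin_pos_of_mem_Ioo hθ).le _) (h0 _ (Real.abs_cos_le_one _))
  · fun_prop
  · exact ae_of_all _ fun w => h0 _ (abs_le.2 ⟨neg_one_le_inner_sphere w v, inner_le_one_sphere w v⟩)
  · exact Measurable.aestronglyMeasurable (by fun_prop)

/-- The approximate identity at `v` on the sphere. -/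
def peakKer {n : ℕ} (ε : ℝ) (v w : Sph n) : ℝ :=
  n * ε ^ 2 / (area n * √(‖(w : E n) - v‖ ^ 2 + ε ^ 2) ^ (n + 2))

theorem sqrt_sq_add_sq_pos {ε : ℝ} (hε : 0 < ε) (r : ℝ) : 0 < √(r ^ 2 + ε ^ 2) :=
  Real.sqrt_pos.2 (by positivity)

theorem le_sqrt_sq_add_sq (ε r : ℝ) : r ≤ √(r ^ 2 + ε ^ 2) :=
  Real.le_sqrt_of_sq_le (by nlinarith [sq_nonneg ε])

theorem continuous_peakKer {n : ℕ} (hn : 1 ≤ n) {ε : ℝ} (hε : 0 < ε) (v : Sph n) :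
    Continuous (peakKer ε v) := by
  unfold peakKer
  refine Continuous.div (by fun_prop) (by fun_prop) fun w => ?_
  have := area_pos hn
  have := sqrt_sq_add_sq_pos hε ‖(w : E n) - v‖
  positivity

theorem peakKer_nonneg {n : ℕ} (ε : ℝ) (v w : Sph n) : 0 ≤ peakKer ε v w := by
  have := area_nonneg n
  unfold peakKer
  positivity

/-- The first factor is the derivative of `F ε θ = (u / √(u² + ε²)) ^ n` with `u = 2 sin (θ/2)`.
Integrate by parts: the boundary terms vanish, since `F ε 0 = 0` and `cos (π/2) = 0`. As `F ε → 1`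
boundedly for `θ > 0`, the limit is minus the total variation of `cos (θ/2) ^ n` from `0` to `π`,
that is, `1`. -/
theorem tendsto_integral_deriv_mul_cos_pow {n : ℕ} (hn : 1 ≤ n) :
    Tendsto (fun ε : ℝ => ∫ θ in (0 : ℝ)..Real.pi,
      (n * ε ^ 2 * (2 * Real.sin (θ / 2)) ^ (n - 1) * Real.cos (θ / 2) /
        √((2 * Real.sin (θ / 2)) ^ 2 + ε ^ 2) ^ (n + 2)) * Real.cos (θ / 2) ^ n)
      (𝓝[>] 0) (𝓝 1) := by
  set F : ℝ → ℝ → ℝ := fun ε θ =>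
    (2 * Real.sin (θ / 2) / √((2 * Real.sin (θ / 2)) ^ 2 + ε ^ 2)) ^ n with hF
  set c' : ℝ → ℝ := fun θ => n * Real.cos (θ / 2) ^ (n - 1) * (-Real.sin (θ / 2) * (1 / 2)) with hc'
  have hcd : ∀ θ, HasDerivAt (fun θ => Real.cos (θ / 2) ^ n) (c' θ) θ := fun θ =>
    (((hasDerivAt_id θ).div_const 2).cos).pow n
  have hcc : Continuous c' := by fun_prop
  have hFd : ∀ ε > 0, ∀ θ, HasDerivAt (F ε)
      (n * ε ^ 2 * (2 * Real.sin (θ / 2)) ^ (n - 1) * Real.cos (θ / 2) /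
        √((2 * Real.sin (θ / 2)) ^ 2 + ε ^ 2) ^ (n + 2)) θ := by
    intro ε hε θ
    have hR := sqrt_sq_add_sq_pos hε (2 * Real.sin (θ / 2))
    have h1 : HasDerivAt (fun θ => 2 * Real.sin (θ / 2)) (Real.cos (θ / 2)) θ := by
      refine (((hasDerivAt_id' θ).div_const 2).sin.const_mul 2).congr_deriv ?_
      ring
    have hsq := Real.sq_sqrt (show 0 ≤ (2 * Real.sin (θ / 2)) ^ 2 + ε ^ 2 by positivity)
    have h2 : HasDerivAt (fun θ => √((2 * Real.sin (θ / 2)) ^ 2 + ε ^ 2))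
        (2 * Real.sin (θ / 2) * Real.cos (θ / 2) / √((2 * Real.sin (θ / 2)) ^ 2 + ε ^ 2)) θ := by
      refine (((h1.pow 2).add_const (ε ^ 2)).sqrt (Real.sqrt_pos.1 hR).ne').congr_deriv ?_
      simp only [Pi.pow_apply]
      field_simp
      push_cast
      ring
    refine ((h1.div h2 hR.ne').pow n).congr_deriv ?_
    simp only [Pi.div_apply]
    generalize √((2 * Real.sin (θ / 2)) ^ 2 + ε ^ 2) = R at *
    generalize 2 * Real.sin (θ / 2) = u at *
    generalize Real.cos (θ / 2) = c at *
    obtain ⟨m, rfl⟩ : ∃ m, n = m + 1 := ⟨n - 1, by omega⟩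
    rw [Nat.add_sub_cancel, div_pow]
    field_simp
    rw [hsq]
    ring
  have hlim : Tendsto (fun ε : ℝ => ∫ θ in (0 : ℝ)..Real.pi, F ε θ * c' θ) (𝓝[>] 0)
      (𝓝 (∫ θ in (0 : ℝ)..Real.pi, c' θ)) := by
    refine intervalIntegral.tendsto_integral_filter_of_dominated_convergence (fun θ => |c' θ|)
      ?_ ?_ ?_ ?_
    · filter_upwards [self_mem_nhdsWithin] with ε hε
      have : Continuous (F ε) := continuous_iff_continuousAt.2 fun θ => (hFd ε hε θ).continuousAt
      exact (this.mul hcc).aestronglyMeasurable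
    · filter_upwards [self_mem_nhdsWithin] with ε hε
      refine ae_of_all _ fun θ hθ => ?_
      rw [norm_mul, Real.norm_eq_abs (c' θ)]
      refine mul_le_of_le_one_left (abs_nonneg _) ?_
      have hR := sqrt_sq_add_sq_pos hε (2 * Real.sin (θ / 2))
      rw [hF, norm_pow]
      refine pow_le_one₀ (norm_nonneg _) ?_
      rw [norm_div, Real.norm_of_nonneg hR.le, div_le_one hR, Real.norm_eq_abs,
        ← sq_abs (2 * Real.sin (θ / 2))]
      exact le_sqrt_sq_add_sq _ _
    · exact (hcc.abs).intervalIntegrable _ _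
    · refine ae_of_all _ fun θ hθ => ?_
      rw [uIoc_of_le Real.pi_pos.le] at hθ
      have hs : 0 < Real.sin (θ / 2) :=
        Real.sin_pos_of_mem_Ioo ⟨by linarith [hθ.1], by linarith [hθ.2, Real.pi_pos]⟩
      have hcont : ContinuousAt (fun ε => F ε θ * c' θ) 0 := by
        have : √((2 * Real.sin (θ / 2)) ^ 2 + (0 : ℝ) ^ 2) ≠ 0 :=
          (Real.sqrt_pos.2 (by positivity)).ne'
        have h : ContinuousAt (fun ε => 2 * Real.sin (θ / 2) /
            √((2 * Real.sin (θ / 2)) ^ 2 + ε ^ 2)) 0 :=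
          ContinuousAt.div (by fun_prop) (by fun_prop) this
        exact (h.pow n).mul continuousAt_const
      have h0 : F 0 θ = 1 := by
        simp only [hF]
        rw [zero_pow two_ne_zero, add_zero, Real.sqrt_sq (by positivity), div_self (by positivity),
          one_pow]
      have := hcont.tendsto
      rw [h0, one_mul] at this
      exact this.mono_left nhdsWithin_le_nhds
  have hone : ∫ θ in (0 : ℝ)..Real.pi, c' θ = -1 := by
    rw [intervalIntegral.integral_eq_sub_of_hasDerivAt (fun θ _ => hcd θ)
      (hcc.intervalIntegrable _ _)]
    simp [Real.cos_pi_div_two, show n ≠ 0 by omega]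
  have key : ∀ᶠ ε : ℝ in 𝓝[>] 0, -∫ θ in (0 : ℝ)..Real.pi, F ε θ * c' θ =
      ∫ θ in (0 : ℝ)..Real.pi, (n * ε ^ 2 * (2 * Real.sin (θ / 2)) ^ (n - 1) * Real.cos (θ / 2) /
        √((2 * Real.sin (θ / 2)) ^ 2 + ε ^ 2) ^ (n + 2)) * Real.cos (θ / 2) ^ n := by
    filter_upwards [self_mem_nhdsWithin] with ε hε
    rw [intervalIntegral.integral_mul_deriv_eq_deriv_mul (fun θ _ => hFd ε hε θ)
      (fun θ _ => hcd θ) _ (hcc.intervalIntegrable _ _)]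
    · have : n ≠ 0 := by omega
      simp [hF, this]
    · refine Continuous.intervalIntegrable (Continuous.div (by fun_prop) (by fun_prop)
        fun θ => ?_) _ _
      exact (pow_pos (sqrt_sq_add_sq_pos hε (2 * Real.sin (θ / 2))) _).ne'
  refine Tendsto.congr' key ?_
  have := hlim.neg
  rwa [hone, neg_neg] at this

/-- Split `1 = (1 + s)/2 + (1 - s)/2` with `s = ⟨w, v⟩ = cos θ`. The first half supplies the factor
`cos² (θ/2)` that turns the zonal integral into the one of `tendsto_integral_deriv_mul_cos_pow`. In
the second, `(1 - s)/2 = ‖w - v‖² / 4` tames the peak and leaves `O(ε)`. -/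
theorem tendsto_integral_peakKer {n : ℕ} (hn : 1 ≤ n) (v : Sph n) :
    Tendsto (fun ε : ℝ => ∫ w, peakKer ε v w ∂surf n) (𝓝[>] 0) (𝓝 1) := by
  have hA := area_pos hn
  have h1 : ∀ᶠ ε : ℝ in 𝓝[>] 0, (∫ θ in (0 : ℝ)..Real.pi,
      (n * ε ^ 2 * (2 * Real.sin (θ / 2)) ^ (n - 1) * Real.cos (θ / 2) /
        √((2 * Real.sin (θ / 2)) ^ 2 + ε ^ 2) ^ (n + 2)) * Real.cos (θ / 2) ^ n) =
      ∫ w : Sph n, peakKer ε v w * ((1 + inner ℝ (w : E n) (v : E n)) / 2) ∂surf n := by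
    filter_upwards [self_mem_nhdsWithin] with ε (hε : 0 < ε)
    have h := integral_zonal hn v
      (f := fun s => n * ε ^ 2 / (area n * √(2 - 2 * s + ε ^ 2) ^ (n + 2)) * ((1 + s) / 2))
      (by fun_prop) fun s hs => by
        have := (abs_le.1 hs).1
        have : 0 ≤ (1 + s) / 2 := by linarith
        positivity
    simp only [← norm_sub_sq_sphere] at h
    unfold peakKer
    rw [h, ← intervalIntegral.integral_const_mul]
    refine intervalIntegral.integral_congr fun θ _ => ?_
    rw [sin_eq_half θ, two_sub_two_cos, one_add_cos_div_two]
    have hR := sqrt_sq_add_sq_pos hε (2 * Real.sin (θ / 2))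
    generalize √((2 * Real.sin (θ / 2)) ^ 2 + ε ^ 2) = R at *
    generalize 2 * Real.sin (θ / 2) = u at *
    generalize Real.cos (θ / 2) = c at *
    obtain ⟨m, rfl⟩ : ∃ m, n = m + 1 := ⟨n - 1, by omega⟩
    rw [Nat.add_sub_cancel, mul_pow]
    field_simp
    ring
  have h2 : Tendsto (fun ε : ℝ => ∫ w : Sph n,
      peakKer ε v w * ((1 - inner ℝ (w : E n) (v : E n)) / 2) ∂surf n) (𝓝[>] 0) (𝓝 0) := by
    have hb : Tendsto (fun ε : ℝ => ε * (n / (4 * area n) *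
        ∫ w : Sph n, (‖(w : E n) - v‖ ^ (n - 1))⁻¹ ∂surf n)) (𝓝[>] 0) (𝓝 0) := by
      refine Tendsto.mono_left ?_ nhdsWithin_le_nhds
      exact Continuous.tendsto' (by fun_prop) _ _ (by simp)
    refine squeeze_zero' ?_ ?_ hb
    · refine Eventually.of_forall fun ε => integral_nonneg fun w => ?_
      exact mul_nonneg (peakKer_nonneg _ _ _) (by linarith [inner_le_one_sphere w v])
    · filter_upwards [self_mem_nhdsWithin] with ε (hε : 0 < ε)
      rw [← integral_const_mul, ← integral_const_mul]
      refine integral_mono_of_nonneg (ae_of_all _ fun w => ?_) ?_ (ae_of_all _ fun w => ?_)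
      · exact mul_nonneg (peakKer_nonneg _ _ _) (by linarith [inner_le_one_sphere w v])
      · exact ((integrable_inv_pow_norm_sub hn v).const_mul _).const_mul _
      · have h3 : (1 - inner ℝ (w : E n) (v : E n)) / 2 = ‖(w : E n) - v‖ ^ 2 / 4 := by
          rw [norm_sub_sq_sphere]; ring
        simp only [h3, peakKer]
        have hR := sqrt_sq_add_sq_pos hε ‖(w : E n) - v‖
        have hR1 := le_sqrt_sq_add_sq ε ‖(w : E n) - v‖
        have hR2 := le_sqrt_sq_add_sq ‖(w : E n) - v‖ ε
        rw [add_comm (ε ^ 2)] at hR2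
        have hr0 := norm_nonneg ((w : E n) - v)
        generalize √(‖(w : E n) - v‖ ^ 2 + ε ^ 2) = R at *
        generalize ‖(w : E n) - v‖ = r at *
        rcases hr0.eq_or_lt with rfl | hr
        · simp; positivity
        -- Of the `n + 2` factors `R`, two absorb `r²`, one is bounded below by `ε`, and the other
        -- `n - 1` by `r`. This spends one power of `ε` and leaves the integrable singularity.
        · have h4 : r ^ 2 * (ε * r ^ (n - 1)) ≤ R ^ (n + 2) := by
            have : R ^ (n + 2) = R ^ 2 * (R * R ^ (n - 1)) := by
              rw [← pow_succ', ← pow_add]; congr 1; omega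
            rw [this]
            gcongr
          have h5 : n * ε ^ 2 / (area n * R ^ (n + 2)) * (r ^ 2 / 4) =
            (n * ε ^ 2 * r ^ 2) / (4 * area n * R ^ (n + 2)) := by field_simp
          have h6 : ε * (n / (4 * area n) * (r ^ (n - 1))⁻¹) =
            (n * ε ^ 2 * r ^ 2) / (4 * area n * (r ^ 2 * (ε * r ^ (n - 1)))) := by field_simp
          rw [h5, h6]
          gcongr
  have h3 := (tendsto_integral_deriv_mul_cos_pow hn).congr' h1 |>.add h2
  rw [add_zero] at h3
  refine h3.congr' ?_
  filter_upwards [self_mem_nhdsWithin] with ε (hε : 0 < ε)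
  have hK := continuous_peakKer hn hε v
  rw [← integral_add]
  · refine integral_congr_ae (ae_of_all _ fun w => ?_)
    simp only
    ring
  all_goals exact (Continuous.integrable_of_hasCompactSupport (by fun_prop)
    (HasCompactSupport.of_compactSpace _))

theorem tendsto_integral_peakKer_smul {n : ℕ} (hn : 1 ≤ n) (v : Sph n) {F : Type*}
    [NormedAddCommGroup F] [NormedSpace ℝ F] [CompleteSpace F] {g : Sph n → F}
    (hg : Continuous g) :
    Tendsto (fun ε : ℝ => ∫ w, peakKer ε v w • g w ∂surf n) (𝓝[>] 0) (𝓝 (g v)) := by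
  have hA := area_pos hn
  have := tendsto_setIntegral_peak_smul_of_integrableOn_of_tendsto (μ := surf n) (s := univ)
    (t := univ) (x₀ := v) (l := 𝓝[>] (0 : ℝ)) (φ := fun ε => peakKer ε v) (g := g) (a := g v)
    MeasurableSet.univ MeasurableSet.univ (subset_univ _) univ_mem (measure_ne_top _ _)
    (Eventually.of_forall fun ε w _ => peakKer_nonneg ε v w) ?_
    (by simpa using tendsto_integral_peakKer hn v) ?_ ?_ ?_
  · simpa using this
  · intro u hu hvu
    obtain ⟨δ, hδ, hδu⟩ := Metric.isOpen_iff.1 hu v hvu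
    rw [Metric.tendstoUniformlyOn_iff]
    intro η hη
    -- At distance at least `δ` from `v` the denominator stays away from zero, so the kernel is
    -- `O(ε²)` uniformly there.
    have hb : Tendsto (fun ε : ℝ => n * ε ^ 2 / (area n * δ ^ (n + 2))) (𝓝[>] 0) (𝓝 0) := by
      refine Tendsto.mono_left ?_ nhdsWithin_le_nhds
      exact Continuous.tendsto' (by fun_prop) _ _ (by simp)
    filter_upwards [(tendsto_order.1 hb).2 η hη] with ε hε w hw
    simp only [Pi.zero_apply, dist_zero_left]
    rw [Real.norm_of_nonneg (peakKer_nonneg _ _ _)]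
    refine lt_of_le_of_lt ?_ hε
    have h1 : δ ≤ ‖(w : E n) - v‖ := by
      by_contra h
      refine hw.2 (hδu ?_)
      rw [Metric.mem_ball, Subtype.dist_eq, dist_eq_norm]
      exact not_le.1 h
    have h2 := h1.trans (le_sqrt_sq_add_sq ε ‖(w : E n) - v‖)
    unfold peakKer
    gcongr
  · filter_upwards [self_mem_nhdsWithin] with ε hε
    exact (continuous_peakKer hn hε v).aestronglyMeasurable
  · exact (hg.integrable_of_hasCompactSupport (HasCompactSupport.of_compactSpace _)).integrableOn
  · exact hg.continuousAt.mono_left nhdsWithin_le_nhds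

/-! ### Differential calculus and integration by parts on the sphere -/

section Calculus

variable {n : ℕ} {V W : Type*} [NormedAddCommGroup V] [NormedSpace ℝ V]
  [NormedAddCommGroup W] [NormedSpace ℝ W]

/-- The open cone over a subset of the sphere. -/
def cone (Ω : Set (Sph n)) : Set (E n) := {x | ∃ w ∈ Ω, ∃ r : ℝ, 0 < r ∧ x = r • (w : E n)}

/-- The radial projection to the sphere. -/
def radProj (x : E n) (hx : x ≠ 0) : Sph n := ⟨‖x‖⁻¹ • x, by simp [norm_smul, hx]⟩

theorem norm_sphere (w : Sph n) : ‖(w : E n)‖ = 1 := by simp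

theorem sphere_ne_zero (w : Sph n) : (w : E n) ≠ 0 := by
  rw [← norm_ne_zero_iff, norm_sphere]
  exact one_ne_zero

theorem homExt_of_ne (f : Sph n → V) {x : E n} (hx : x ≠ 0) : homExt f x = f (radProj x hx) := by
  rw [homExt, dif_neg hx, radProj]

theorem radProj_smul (w : Sph n) {r : ℝ} (hr : 0 < r) (h : r • (w : E n) ≠ 0) :
    radProj (r • (w : E n)) h = w := by
  refine Subtype.ext ?_
  simp [radProj, norm_smul, abs_of_pos hr, smul_smul, hr.ne']

theorem smul_sphere_ne_zero (w : Sph n) {r : ℝ} (hr : 0 < r) : r • (w : E n) ≠ 0 :=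
  smul_ne_zero hr.ne' (sphere_ne_zero w)

theorem homExt_smul_coe (f : Sph n → V) (w : Sph n) {r : ℝ} (hr : 0 < r) :
    homExt f (r • (w : E n)) = f w := by
  rw [homExt_of_ne f (smul_sphere_ne_zero w hr), radProj_smul w hr]

theorem homExt_coe (f : Sph n → V) (w : Sph n) : homExt f (w : E n) = f w := by
  simpa using homExt_smul_coe f w one_pos

theorem mem_cone_iff {Ω : Set (Sph n)} {x : E n} :
    x ∈ cone Ω ↔ ∃ hx : x ≠ 0, radProj x hx ∈ Ω := by
  constructor
  · rintro ⟨w, hw, r, hr, rfl⟩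
    exact ⟨smul_sphere_ne_zero w hr, by rwa [radProj_smul w hr]⟩
  · rintro ⟨hx, h⟩
    exact ⟨_, h, ‖x‖, norm_pos_iff.2 hx, by simp [radProj, smul_smul, hx]⟩

theorem coe_mem_cone {Ω : Set (Sph n)} {w : Sph n} (hw : w ∈ Ω) : (w : E n) ∈ cone Ω :=
  ⟨w, hw, 1, one_pos, (one_smul _ _).symm⟩

theorem ne_zero_of_mem_cone {Ω : Set (Sph n)} {x : E n} (hx : x ∈ cone Ω) : x ≠ 0 :=
  (mem_cone_iff.1 hx).1

theorem cone_mono {Ω Ω' : Set (Sph n)} (h : Ω ⊆ Ω') : cone Ω ⊆ cone Ω' :=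
  fun _ ⟨w, hw, r, hr, hx⟩ => ⟨w, h hw, r, hr, hx⟩

theorem contDiffAt_normalize {k : WithTop ℕ∞} {x : E n} (hx : x ≠ 0) :
    ContDiffAt ℝ k (fun x : E n => ‖x‖⁻¹ • x) x :=
  ((contDiffAt_norm ℝ hx).inv (norm_ne_zero_iff.2 hx)).smul contDiffAt_id

theorem isOpen_cone {Ω : Set (Sph n)} (hΩ : IsOpen Ω) : IsOpen (cone Ω) := by
  obtain ⟨U, hU, rfl⟩ := isOpen_induced_iff.1 hΩ
  have : cone (Subtype.val ⁻¹' U) = ({0}ᶜ : Set (E n)) ∩ (fun x : E n => ‖x‖⁻¹ • x) ⁻¹' U := by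
    ext x
    rw [mem_cone_iff]
    exact ⟨fun ⟨h, h'⟩ => ⟨h, h'⟩, fun ⟨h, h'⟩ => ⟨h, h'⟩⟩
  rw [this]
  exact ContinuousOn.isOpen_inter_preimage (fun x hx =>
    (contDiffAt_normalize (k := 0) hx).continuousAt.continuousWithinAt) isOpen_compl_singleton hU

theorem CkOn.contDiffAt {k : WithTop ℕ∞} {f : Sph n → V} {Ω : Set (Sph n)} (hf : CkOn k f Ω)
    (hΩ : IsOpen Ω) {x : E n} (hx : x ∈ cone Ω) : ContDiffAt ℝ k (homExt f) x :=
  ContDiffOn.contDiffAt hf ((isOpen_cone hΩ).mem_nhds hx)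

theorem CkOn.mono {k : WithTop ℕ∞} {f : Sph n → V} {Ω Ω' : Set (Sph n)} (hf : CkOn k f Ω)
    (h : Ω' ⊆ Ω) : CkOn k f Ω' :=
  ContDiffOn.mono hf (cone_mono h)

theorem CkOn.of_le {k l : WithTop ℕ∞} {f : Sph n → V} {Ω : Set (Sph n)} (hf : CkOn k f Ω)
    (h : l ≤ k) : CkOn l f Ω :=
  ContDiffOn.of_le hf h

theorem CkOn.continuousOn {k : WithTop ℕ∞} {f : Sph n → V} {Ω : Set (Sph n)} (hf : CkOn k f Ω) :
    ContinuousOn f Ω := by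
  have h := (ContDiffOn.continuousOn hf).comp (f := fun w : Sph n => (w : E n)) (s := Ω)
    continuous_subtype_val.continuousOn fun w hw => coe_mem_cone hw
  exact h.congr fun w _ => (homExt_coe f w).symm

theorem CkOn.continuous {k : WithTop ℕ∞} {f : Sph n → V} (hf : CkOn k f univ) : Continuous f :=
  continuousOn_univ.1 hf.continuousOn

theorem ckOn_restrict {k : WithTop ℕ∞} {g : E n → V} {Ω : Set (Sph n)}
    (hg : ∀ w ∈ Ω, ContDiffAt ℝ k g w) : CkOn k (fun w : Sph n => g w) Ω := by
  intro x hx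
  obtain ⟨hx0, hxΩ⟩ := mem_cone_iff.1 hx
  have h1 : ContDiffAt ℝ k (fun x : E n => g (‖x‖⁻¹ • x)) x :=
    ContDiffAt.comp x (hg _ hxΩ) (contDiffAt_normalize hx0)
  refine (h1.congr_of_eventuallyEq ?_).contDiffWithinAt
  filter_upwards [isOpen_ne.mem_nhds hx0] with y hy
  rw [homExt_of_ne _ hy]
  rfl

theorem homExt_comp (L : V → W) (f : Sph n → V) {x : E n} (hx : x ≠ 0) :
    homExt (fun w => L (f w)) x = L (homExt f x) := by
  rw [homExt_of_ne _ hx, homExt_of_ne _ hx]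

theorem CkOn.smul {k : WithTop ℕ∞} {ψ : Sph n → ℝ} {f : Sph n → V} {Ω : Set (Sph n)}
    (hψ : CkOn k ψ Ω) (hf : CkOn k f Ω) : CkOn k (fun w => ψ w • f w) Ω := by
  refine (ContDiffOn.smul hψ hf).congr fun x hx => ?_
  have h0 := ne_zero_of_mem_cone hx
  simp only [Pi.smul_apply', homExt_of_ne _ h0]

theorem CkOn.differentiableAt {f : Sph n → V} {Ω : Set (Sph n)} (hf : CkOn 1 f Ω)
    (hΩ : IsOpen Ω) {w : Sph n} (hw : w ∈ Ω) : DifferentiableAt ℝ (homExt f) w :=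
  (hf.contDiffAt hΩ (coe_mem_cone hw)).differentiableAt one_ne_zero

theorem CkOn.continuousOn_fderiv {f : Sph n → V} {Ω : Set (Sph n)} (hf : CkOn 1 f Ω)
    (hΩ : IsOpen Ω) : ContinuousOn (fun w : Sph n => fderiv ℝ (homExt f) w) Ω :=
  (ContDiffOn.continuousOn_fderiv_of_isOpen hf (isOpen_cone hΩ) le_rfl).comp
    continuous_subtype_val.continuousOn fun _ hw => coe_mem_cone hw

/-- The rotation field `x_a e_b - x_b e_a`. -/
def rotVec (a b : Fin (n + 1)) (x : E n) : E n :=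
  x a • EuclideanSpace.single b 1 - x b • EuclideanSpace.single a 1

theorem rotDeriv_eq (a b : Fin (n + 1)) (f : Sph n → V) (w : Sph n) :
    rotDeriv a b f w = fderiv ℝ (homExt f) w (rotVec a b w) := rfl

theorem continuous_rotVec (a b : Fin (n + 1)) : Continuous (rotVec (n := n) a b) := by
  unfold rotVec
  fun_prop

theorem CkOn.continuousOn_rotDeriv {f : Sph n → V} {Ω : Set (Sph n)} (hf : CkOn 1 f Ω)
    (hΩ : IsOpen Ω) (a b : Fin (n + 1)) : ContinuousOn (rotDeriv a b f) Ω :=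
  (hf.continuousOn_fderiv hΩ).clm_apply
    ((continuous_rotVec a b).comp continuous_subtype_val).continuousOn

theorem rotDeriv_smul {ψ : Sph n → ℝ} {f : Sph n → V} {w : Sph n}
    (hψ : DifferentiableAt ℝ (homExt ψ) w) (hf : DifferentiableAt ℝ (homExt f) w)
    (a b : Fin (n + 1)) :
    rotDeriv a b (fun w => ψ w • f w) w = ψ w • rotDeriv a b f w + rotDeriv a b ψ w • f w := by
  have : homExt (fun w => ψ w • f w) =ᶠ[𝓝 (w : E n)] fun x => homExt ψ x • homExt f x := by
    filter_upwards [isOpen_ne.mem_nhds (sphere_ne_zero w)] with y hy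
    simp only [homExt_of_ne _ hy]
  simp only [rotDeriv_eq]
  rw [this.fderiv_eq, fderiv_fun_smul hψ hf]
  simp [homExt_coe]

theorem rotDeriv_clm {f : Sph n → V} {w : Sph n} (L : V →L[ℝ] W)
    (hf : DifferentiableAt ℝ (homExt f) w) (a b : Fin (n + 1)) :
    rotDeriv a b (fun w => L (f w)) w = L (rotDeriv a b f w) := by
  have : homExt (fun w => L (f w)) =ᶠ[𝓝 (w : E n)] L ∘ homExt f := by
    filter_upwards [isOpen_ne.mem_nhds (sphere_ne_zero w)] with y hy
    exact homExt_comp L f hy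
  simp only [rotDeriv_eq]
  rw [this.fderiv_eq, (L.hasFDerivAt.comp (w : E n) hf.hasFDerivAt).fderiv]
  rfl

theorem homExt_eventually_zero {f : Sph n → V} {w : Sph n} (hw : w ∉ tsupport f) :
    homExt f =ᶠ[𝓝 (w : E n)] 0 := by
  have hO : IsOpen (cone (tsupport f)ᶜ) := isOpen_cone (isClosed_tsupport f).isOpen_compl
  filter_upwards [hO.mem_nhds (coe_mem_cone hw)] with y hy
  obtain ⟨hy0, hy1⟩ := mem_cone_iff.1 hy
  rw [homExt_of_ne f hy0]
  exact image_eq_zero_of_notMem_tsupport hy1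

theorem rotDeriv_eq_zero_of_notMem {f : Sph n → V} {w : Sph n} (hw : w ∉ tsupport f)
    (a b : Fin (n + 1)) : rotDeriv a b f w = 0 := by
  rw [rotDeriv_eq, (homExt_eventually_zero hw).fderiv_eq]
  simp

/-- The rotation fields are divergence free on the sphere. -/
theorem integral_rotDeriv {f : Sph n → V} (hf : CkOn 1 f univ) {a b : Fin (n + 1)} (hab : a ≠ b) :
    ∫ w, rotDeriv a b f w ∂surf n = 0 := by
  set u : ℝ → E n := fun t =>
    Real.cos t • EuclideanSpace.single a 1 + Real.sin t • EuclideanSpace.single b 1 with hu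
  set u' : ℝ → E n := fun t =>
    -Real.sin t • EuclideanSpace.single a 1 + Real.cos t • EuclideanSpace.single b 1 with hu'
  have hud : ∀ t, HasDerivAt u (u' t) t := fun t =>
    ((Real.hasDerivAt_cos t).smul_const _).add ((Real.hasDerivAt_sin t).smul_const _)
  have hun : ∀ t, ‖u t‖ = 1 := by
    intro t
    have : ‖u t‖ ^ 2 = 1 := by
      rw [hu, norm_add_sq_real]
      simp [inner_smul_left, inner_smul_right, norm_smul, hab,
        EuclideanSpace.inner_single_left]
    nlinarith [norm_nonneg (u t)]
  -- The flow of the field is realized by reflections in the moving line spanned by `u t`: they are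
  -- isometries at once, and `ρ t ∘ ρ 0` is the rotation by `2t` in the plane of the axes `a` and
  -- `b`.
  set ρ : ℝ → E n → E n := fun t x => (2 * inner ℝ (u t) x) • u t - x with hρ
  have hρr : ∀ t x, (ℝ ∙ u t).reflection x = ρ t x := by
    intro t x
    rw [Submodule.reflection_singleton_apply, hun]
    simp [hρ, two_smul, two_mul, add_smul]
  have hρn : ∀ t (w : Sph n), ‖ρ t w‖ = 1 := fun t w => by rw [← hρr]; simp
  set g : ℝ → Sph n → Sph n := fun t w => ⟨ρ t w, by simp [hρn]⟩ with hg
  have hmp : ∀ t, MeasurePreserving (g t) (surf n) (surf n) := fun t =>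
    measurePreserving_sphere (ℝ ∙ u t).reflection (g t) fun w => (hρr t w).symm
  set ρ' : ℝ → E n → E n := fun t x =>
    (2 * inner ℝ (u t) x) • u' t + (2 * inner ℝ (u' t) x) • u t with hρ'
  have hρd : ∀ x t, HasDerivAt (fun t => ρ t x) (ρ' t x) t := by
    intro x t
    have h1 := (((hud t).inner ℝ (hasDerivAt_const t x)).const_mul 2)
    have h2 := (h1.smul (hud t)).sub_const x
    refine h2.congr_deriv ?_
    simp [hρ']
  have hfd : ∀ w : Sph n, DifferentiableAt ℝ (homExt f) w := fun w =>
    hf.differentiableAt isOpen_univ (mem_univ w)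
  have hfc : Continuous fun w : Sph n => fderiv ℝ (homExt f) w :=
    continuousOn_univ.1 (hf.continuousOn_fderiv isOpen_univ)
  have hfcont : Continuous f := hf.continuous
  obtain ⟨M, hM⟩ := (isCompact_univ (X := Sph n)).exists_bound_of_continuousOn hfc.continuousOn
  -- Crude constants: only some uniform bound is needed to differentiate under the integral.
  have hu'n : ∀ t, ‖u' t‖ ≤ 2 := by
    intro t
    refine (norm_add_le _ _).trans ?_
    simp only [norm_smul, PiLp.norm_single, norm_neg, norm_one, mul_one, Real.norm_eq_abs]
    linarith [Real.abs_sin_le_one t, Real.abs_cos_le_one t]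
  have hρ'n : ∀ t (w : Sph n), ‖ρ' t w‖ ≤ 8 := by
    intro t w
    have h1 : |inner ℝ (u t) (w : E n)| ≤ 1 := by
      simpa [hun] using abs_real_inner_le_norm (u t) (w : E n)
    have h2 : |inner ℝ (u' t) (w : E n)| ≤ 2 := by
      refine (abs_real_inner_le_norm (u' t) (w : E n)).trans ?_
      simpa using hu'n t
    refine (norm_add_le _ _).trans ?_
    simp only [norm_smul, hun, norm_mul, Real.norm_eq_abs, abs_two]
    have h3 := hu'n t
    nlinarith [norm_nonneg (u' t), abs_nonneg (inner ℝ (u t) (w : E n))]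
  have hgc : ∀ t, Continuous (g t) := fun t => by
    refine Continuous.subtype_mk ?_ _
    simp only [hρ]
    fun_prop
  have key := hasDerivAt_integral_of_dominated_loc_of_deriv_le (μ := surf n) (x₀ := (0 : ℝ))
    (s := univ) (bound := fun _ => M * 8) (F := fun t w => f (g t w))
    (F' := fun t w => fderiv ℝ (homExt f) (g t w) (ρ' t w)) univ_mem ?_ ?_ ?_ ?_ ?_ ?_
  -- The integral of `f ∘ g t` does not depend on `t`, so its derivative at `0` vanishes. That
  -- derivative is twice the wanted integral after the change of variables `g 0`.
  · have hconst : (fun t => ∫ w, f (g t w) ∂surf n) = fun _ => ∫ w, f w ∂surf n := by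
      funext t
      conv_rhs => rw [← (hmp t).map_eq]
      rw [integral_map (hgc t).measurable.aemeasurable hfcont.aestronglyMeasurable]
    have h0 := key.2
    rw [hconst] at h0
    have h1 := h0.unique (hasDerivAt_const _ _)
    have h2 : ∀ w : Sph n, fderiv ℝ (homExt f) (g 0 w) (ρ' 0 w) = (2 : ℝ) • rotDeriv a b f (g 0 w) := by
      intro w
      rw [rotDeriv_eq, ← map_smul]
      congr 1
      simp [hρ', hu, hu', rotVec, hg, hρ, EuclideanSpace.inner_single_left, hab.symm]
      module
    simp only [h2, integral_smul] at h1
    have h3 := (smul_eq_zero.1 h1).resolve_left two_ne_zero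
    rw [← (hmp 0).map_eq, integral_map (hgc 0).measurable.aemeasurable]
    · exact h3
    · exact (continuousOn_univ.1
        (hf.continuousOn_rotDeriv isOpen_univ a b)).aestronglyMeasurable
  · exact Eventually.of_forall fun t => (hfcont.comp (hgc t)).aestronglyMeasurable
  · exact (hfcont.comp (hgc 0)).integrable_of_hasCompactSupport
      (HasCompactSupport.of_compactSpace _)
  · refine Continuous.aestronglyMeasurable ((hfc.comp (hgc 0)).clm_apply ?_)
    simp only [hρ']
    fun_prop
  · refine ae_of_all _ fun w t _ => ?_
    have h1 := hM (g t w) (mem_univ _)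
    exact (ContinuousLinearMap.le_of_opNorm_le_of_le _ h1 (hρ'n t w))
  · exact integrable_const _
  · refine ae_of_all _ fun w t _ => ?_
    have h1 : HasFDerivAt (homExt f) (fderiv ℝ (homExt f) (g t w)) (ρ t w) :=
      (hfd (g t w)).hasFDerivAt
    have h2 := h1.comp_hasDerivAt t (hρd w t)
    refine h2.congr_of_eventuallyEq (Eventually.of_forall fun s => ?_)
    exact (homExt_coe f (g s w)).symm

/-- Local integrability in `Ω` gives integrability on the compact set `K`, off which `F` vanishes.
This makes the pairings with test functions converge. -/
theorem integrable_of_norm_le_of_isCompact {μ : Measure (Sph n)} {Ω K : Set (Sph n)} {g : Sph n → V}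
    {F : Sph n → W}
    (hg : LocallyIntegrableOn g Ω μ) (hK : IsCompact K) (hKΩ : K ⊆ Ω)
    (hF : AEStronglyMeasurable F (μ.restrict Ω)) (C : ℝ) (hC : ∀ w, ‖F w‖ ≤ C * ‖g w‖)
    (h0 : ∀ w, w ∉ K → F w = 0) : Integrable F (μ.restrict Ω) := by
  have h1 : IntegrableOn g K μ := hg.integrableOn_compact_subset hKΩ hK
  have h2 : IntegrableOn F K μ :=
    Integrable.mono' (h1.norm.const_mul C) (hF.mono_measure (Measure.restrict_mono hKΩ le_rfl))
      (ae_of_all _ hC)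
  have h3 : IntegrableOn F (K ∪ (univ \ K)) (μ.restrict Ω) := by
    refine IntegrableOn.union ?_ ?_
    · rw [IntegrableOn, Measure.restrict_restrict hK.measurableSet, inter_eq_left.2 hKΩ]
      exact h2
    · exact integrableOn_zero.congr_fun (fun w hw => (h0 w hw.2).symm)
        (MeasurableSet.univ.diff hK.measurableSet)
  rwa [union_sdiff_self, union_univ, integrableOn_univ] at h3

theorem integrable_smul_of_tsupport {Ω : Set (Sph n)} {ψ : Sph n → ℝ} (hψ : Continuous ψ)
    (hs : tsupport ψ ⊆ Ω) {g : Sph n → V} (hg : LocallyIntegrableOn g Ω (surf n)) :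
    Integrable (fun w => ψ w • g w) ((surf n).restrict Ω) := by
  obtain ⟨C, hC⟩ := (isCompact_univ (X := Sph n)).exists_bound_of_continuousOn hψ.continuousOn
  refine integrable_of_norm_le_of_isCompact hg (isClosed_tsupport ψ).isCompact hs
    (hψ.aestronglyMeasurable.smul hg.aestronglyMeasurable) C (fun w => ?_) fun w hw => ?_
  · rw [norm_smul]
    exact mul_le_mul_of_nonneg_right (hC w (mem_univ w)) (norm_nonneg _)
  · rw [image_eq_zero_of_notMem_tsupport hw, zero_smul]

theorem setIntegral_eq_integral_of_tsupport {Ω : Set (Sph n)} {ψ : Sph n → ℝ}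
    (hs : tsupport ψ ⊆ Ω) {F : Sph n → V} (hF : ∀ w, w ∉ tsupport ψ → F w = 0) :
    ∫ w in Ω, F w ∂surf n = ∫ w, F w ∂surf n :=
  setIntegral_eq_integral_of_forall_compl_eq_zero fun w hw => hF w fun h => hw (hs h)

theorem tsupport_rotDeriv_subset (f : Sph n → V) (a b : Fin (n + 1)) :
    tsupport (rotDeriv a b f) ⊆ tsupport f :=
  closure_minimal (fun w hw => by
    by_contra h
    exact hw (rotDeriv_eq_zero_of_notMem h a b)) (isClosed_tsupport f)

/-- Integration by parts on the sphere. -/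
theorem integral_smul_rotDeriv {Ω : Set (Sph n)} (hΩ : IsOpen Ω) {ψ : Sph n → ℝ}
    (hψ : CkOn 1 ψ univ) (hs : tsupport ψ ⊆ Ω) {f : Sph n → V} (hf : CkOn 1 f Ω)
    {a b : Fin (n + 1)} (hab : a ≠ b) :
    ∫ w in Ω, ψ w • rotDeriv a b f w ∂surf n = -∫ w in Ω, rotDeriv a b ψ w • f w ∂surf n := by
  have hsupp : tsupport (fun w => ψ w • f w) ⊆ tsupport ψ := tsupport_smul_subset_left ψ f
  -- Nothing is known about `f` off `Ω`, but such points lie in the open complement of `tsupport ψ`,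
  -- where the product is locally zero.
  have hprod : CkOn 1 (fun w => ψ w • f w) univ := by
    intro x hx
    obtain ⟨hx0, -⟩ := mem_cone_iff.1 hx
    by_cases h : radProj x hx0 ∈ Ω
    · exact (((hψ.mono (subset_univ _)).smul hf).contDiffAt hΩ
        (mem_cone_iff.2 ⟨hx0, h⟩)).contDiffWithinAt
    · have hO : IsOpen (cone (tsupport ψ)ᶜ) := isOpen_cone (isClosed_tsupport ψ).isOpen_compl
      have hxO : x ∈ cone (tsupport ψ)ᶜ := mem_cone_iff.2 ⟨hx0, fun h' => h (hs h')⟩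
      have h0 : homExt (fun w => ψ w • f w) =ᶠ[𝓝 x] fun _ => 0 := by
        filter_upwards [hO.mem_nhds hxO] with y hy
        obtain ⟨hy0, hy1⟩ := mem_cone_iff.1 hy
        rw [homExt_of_ne _ hy0, image_eq_zero_of_notMem_tsupport hy1, zero_smul]
      exact (contDiffAt_const.congr_of_eventuallyEq h0).contDiffWithinAt
  have h1 : ∫ w in Ω, rotDeriv a b (fun w => ψ w • f w) w ∂surf n = 0 := by
    rw [setIntegral_eq_integral_of_tsupport hs, integral_rotDeriv hprod hab]
    exact fun w hw => rotDeriv_eq_zero_of_notMem (fun h => hw (hsupp h)) a b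
  have h2 : ∫ w in Ω, (ψ w • rotDeriv a b f w + rotDeriv a b ψ w • f w) ∂surf n = 0 := by
    rw [← h1]
    refine setIntegral_congr_fun hΩ.measurableSet fun w hw => ?_
    exact (rotDeriv_smul (hψ.differentiableAt isOpen_univ (mem_univ w))
      (hf.differentiableAt hΩ hw) a b).symm
  rw [integral_add] at h2
  · exact eq_neg_of_add_eq_zero_left h2
  · exact integrable_smul_of_tsupport hψ.continuous hs
      ((hf.continuousOn_rotDeriv hΩ a b).locallyIntegrableOn hΩ.measurableSet)
  · exact integrable_smul_of_tsupport (continuousOn_univ.1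
      (hψ.continuousOn_rotDeriv isOpen_univ a b)) ((tsupport_rotDeriv_subset ψ a b).trans hs)
      (hf.continuousOn.locallyIntegrableOn hΩ.measurableSet)

end Calculus

/-! ### Clifford identities for paravectors and the coefficients of `Γ₀` -/

section Clifford

variable {n : ℕ}

/-- The multiplication of the Clifford algebra as a continuous bilinear map. -/
def mulCL (n : ℕ) : Cl n →L[ℝ] Cl n →L[ℝ] Cl n := (LinearMap.mul ℝ (Cl n)).toContinuousBilinearMap

theorem mulCL_apply (a b : Cl n) : mulCL n a b = a * b := rfl

instance : ContinuousMul (Cl n) where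
  continuous_mul := (mulCL n).continuous₂

theorem norm_mul_le_mulCL (a b : Cl n) : ‖a * b‖ ≤ ‖mulCL n‖ * ‖a‖ * ‖b‖ :=
  (mulCL n).le_opNorm₂ a b

/-- The basis `1, e₁, …, eₙ` of the paravectors. -/
def eHat : Fin (n + 1) → Cl n := Fin.cases 1 e

/-- The conjugates `1, -e₁, …, -eₙ` of the basis of the paravectors. -/
def eBar : Fin (n + 1) → Cl n := Fin.cases 1 fun j => -e j

theorem eHat_zero : eHat (0 : Fin (n + 1)) = 1 := rfl
theorem eHat_succ (j : Fin n) : eHat j.succ = e j := rfl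
theorem eBar_zero : eBar (0 : Fin (n + 1)) = 1 := rfl
theorem eBar_succ (j : Fin n) : eBar j.succ = -e j := rfl

theorem par_eq_sum (x : E n) : par x = ∑ a, x a • eHat a := by
  rw [Fin.sum_univ_succ, par, eHat_zero, Algebra.algebraMap_eq_smul_one]
  rfl

theorem parBar_eq_sum (x : E n) : parBar x = ∑ a, x a • eBar a := by
  rw [Fin.sum_univ_succ, parBar, par, eBar_zero, map_add, map_sum]
  simp [e, Algebra.algebraMap_eq_smul_one, eBar_succ]

theorem e_mul_e_add (i j : Fin n) : e i * e j + e j * e i = if i = j then -2 else 0 := by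
  rw [e, e, CliffordAlgebra.ι_mul_ι_add_swap]
  have : QuadraticMap.polar (negForm n) (Pi.single i 1) (Pi.single j 1) = if i = j then -2 else 0 := by
    simp only [QuadraticMap.polar, negForm, QuadraticMap.weightedSumSquares_apply]
    rw [← Finset.sum_sub_distrib, ← Finset.sum_sub_distrib]
    have h : ∀ x : Fin n, (-1 : ℝ) • ((Pi.single i (1 : ℝ) + Pi.single j 1 : Fin n → ℝ) x
        * (Pi.single i (1 : ℝ) + Pi.single j 1 : Fin n → ℝ) x)
        - (-1 : ℝ) • ((Pi.single i (1 : ℝ) : Fin n → ℝ) x * (Pi.single i (1 : ℝ) : Fin n → ℝ) x)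
        - (-1 : ℝ) • ((Pi.single j (1 : ℝ) : Fin n → ℝ) x * (Pi.single j (1 : ℝ) : Fin n → ℝ) x)
        = (Pi.single i (1 : ℝ) : Fin n → ℝ) x * (-2 * (Pi.single j (1 : ℝ) : Fin n → ℝ) x) := by
      intro x
      simp only [Pi.add_apply, smul_eq_mul]
      ring
    rw [Finset.sum_congr rfl fun x _ => h x]
    simp [Pi.single_apply, eq_comm (a := j), apply_ite]
  rw [this]
  split_ifs
  · rw [map_neg, map_ofNat]
  · rw [map_zero]

theorem eBar_mul_eHat_add (a b : Fin (n + 1)) :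
    eBar a * eHat b + eBar b * eHat a = if a = b then 2 else 0 := by
  refine Fin.cases ?_ (fun i => ?_) a <;> refine Fin.cases ?_ (fun j => ?_) b
  · simp [eHat_zero, eBar_zero, one_add_one_eq_two]
  · simp [eHat_zero, eBar_zero, eHat_succ, eBar_succ, (Fin.succ_ne_zero j).symm]
  · simp [eHat_zero, eBar_zero, eHat_succ, eBar_succ]
  · have := e_mul_e_add i j
    simp only [eHat_succ, eBar_succ, neg_mul, ← neg_add, this, Fin.succ_inj]
    split_ifs <;> simp

theorem eHat_mul_eBar_add (a b : Fin (n + 1)) :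
    eHat a * eBar b + eHat b * eBar a = if a = b then 2 else 0 := by
  refine Fin.cases ?_ (fun i => ?_) a <;> refine Fin.cases ?_ (fun j => ?_) b
  · simp [eHat_zero, eBar_zero, one_add_one_eq_two]
  · simp [eHat_zero, eBar_zero, eHat_succ, eBar_succ, (Fin.succ_ne_zero j).symm]
  · simp [eHat_zero, eBar_zero, eHat_succ, eBar_succ]
  · have := e_mul_e_add i j
    simp only [eHat_succ, eBar_succ, mul_neg, ← neg_add, this, Fin.succ_inj]
    split_ifs <;> simp

theorem two_smul_cancel {a b : Cl n} (h : a + a = b + b) : a = b := by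
  rw [← two_smul ℝ, ← two_smul ℝ b] at h
  exact smul_right_injective _ (two_ne_zero (α := ℝ)) h

theorem eBar_mul_eHat_self (a : Fin (n + 1)) : eBar a * eHat a = (1 : Cl n) :=
  two_smul_cancel (by rw [eBar_mul_eHat_add, if_pos rfl, one_add_one_eq_two])

theorem eHat_mul_eBar_self (a : Fin (n + 1)) : eHat a * eBar a = (1 : Cl n) :=
  two_smul_cancel (by rw [eHat_mul_eBar_add, if_pos rfl, one_add_one_eq_two])

theorem parBar_mul_par_add (x y : E n) :
    parBar x * par y + parBar y * par x = (2 * inner ℝ x y) • (1 : Cl n) := by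
  simp only [par_eq_sum, parBar_eq_sum, Finset.sum_mul_sum, smul_mul_smul_comm]
  rw [Finset.sum_comm (f := fun i j => (y i * x j) • (eBar i * eHat j)), ← Finset.sum_add_distrib]
  have : ∀ i j : Fin (n + 1), (x i * y j) • (eBar i * eHat j) + (y j * x i) • (eBar j * eHat i) =
      if i = j then (2 * (x i * y j)) • (1 : Cl n) else 0 := by
    intro i j
    rw [mul_comm (y j), ← smul_add, eBar_mul_eHat_add]
    split_ifs
    · rw [mul_comm 2, mul_smul _ (2 : ℝ), two_smul, one_add_one_eq_two]
    · rw [smul_zero]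
  simp only [← Finset.sum_add_distrib, this, Finset.sum_ite_eq, Finset.mem_univ, if_true]
  rw [← Finset.sum_smul, ← Finset.mul_sum]
  congr 2
  simp [PiLp.inner_apply, mul_comm]

theorem par_mul_parBar_add (x y : E n) :
    par x * parBar y + par y * parBar x = (2 * inner ℝ x y) • (1 : Cl n) := by
  simp only [par_eq_sum, parBar_eq_sum, Finset.sum_mul_sum, smul_mul_smul_comm]
  rw [Finset.sum_comm (f := fun i j => (y i * x j) • (eHat i * eBar j)), ← Finset.sum_add_distrib]
  have : ∀ i j : Fin (n + 1), (x i * y j) • (eHat i * eBar j) + (y j * x i) • (eHat j * eBar i) =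
      if i = j then (2 * (x i * y j)) • (1 : Cl n) else 0 := by
    intro i j
    rw [mul_comm (y j), ← smul_add, eHat_mul_eBar_add]
    split_ifs
    · rw [mul_comm 2, mul_smul _ (2 : ℝ), two_smul, one_add_one_eq_two]
    · rw [smul_zero]
  simp only [← Finset.sum_add_distrib, this, Finset.sum_ite_eq, Finset.mem_univ, if_true]
  rw [← Finset.sum_smul, ← Finset.mul_sum]
  congr 2
  simp [PiLp.inner_apply, mul_comm]

theorem par_mul_parBar_sphere (w : Sph n) : par (w : E n) * parBar (w : E n) = 1 :=
  two_smul_cancel (by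
    rw [par_mul_parBar_add, real_inner_self_eq_norm_sq, norm_sphere, one_pow, mul_one, two_smul])

/-- `x ↦ x̄` as a continuous linear map. -/
def parBarCL (n : ℕ) : E n →L[ℝ] Cl n :=
  ∑ a, (EuclideanSpace.proj a : E n →L[ℝ] ℝ).smulRight (eBar a)

theorem parBarCL_apply (x : E n) : parBarCL n x = parBar x := by
  rw [parBar_eq_sum, parBarCL]
  simp

theorem continuous_parBar : Continuous (parBar : E n → Cl n) := by
  simp only [← funext parBarCL_apply]
  exact (parBarCL n).continuous

theorem parBar_sub (x y : E n) : parBar (x - y) = parBar x - parBar y := by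
  simp only [← parBarCL_apply, map_sub]

/-- The first order operator `∑ c_{ab} (x_a ∂_b - x_b ∂_a)` on the sphere. -/
def angOp (c : Fin (n + 1) → Fin (n + 1) → Cl n) (f : Sph n → Cl n) (w : Sph n) : Cl n :=
  ∑ a, ∑ b, c a b * rotDeriv a b f w

/-- The coefficients of `Γ₀`. -/
def gamC (a b : Fin (n + 1)) : Cl n := if a < b then eBar a * eHat b else 0

/-- The coefficients of `Γ̄₀`. -/
def gamBarC (a b : Fin (n + 1)) : Cl n := if a < b then eHat a * eBar b else 0

/-- With `e₀ = 1`, the products `ē_a e_b` for `a < b` are `e_b` if `a = 0` and `-e_a e_b` otherwise,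
so both sums in `Γ₀` become one. -/
theorem Gam_eq_angOp (f : Sph n → Cl n) : Gam f = angOp gamC f := by
  funext w
  simp only [angOp, Gam, Fin.sum_univ_succ (n := n), gamC]
  simp [eBar_zero, eHat_succ, eBar_succ, Fin.succ_pos, Fin.succ_lt_succ_iff, sub_eq_add_neg,
    ← Finset.sum_neg_distrib, ← Finset.sum_filter, Finset.filter_lt_eq_Ioi]

theorem GamBar_eq_angOp (f : Sph n → Cl n) : GamBar f = angOp gamBarC f := by
  funext w
  simp only [angOp, GamBar, Fin.sum_univ_succ (n := n), gamBarC]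
  simp [eHat_zero, eHat_succ, eBar_succ, Fin.succ_pos, Fin.succ_lt_succ_iff, sub_eq_add_neg,
    ← Finset.sum_neg_distrib, ← Finset.sum_filter, Finset.filter_lt_eq_Ioi]

/-- Off the diagonal `ē_a e_b` is antisymmetric, hence `gamC a b - gamC b a = ē_a e_b - δ_ab`. The
sum over `a < b` thus becomes a full double sum, which factors in the applications. -/
theorem sum_gamC_mul_sub (X : Fin (n + 1) → Fin (n + 1) → Cl n) :
    ∑ a, ∑ b, gamC a b * (X a b - X b a) =
      ∑ a, ∑ b, eBar a * eHat b * X a b - ∑ a, X a a := by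
  have h1 : ∑ a, ∑ b, gamC a b * (X a b - X b a) =
      ∑ a, ∑ b, (gamC a b - gamC b a) * X a b := by
    simp only [mul_sub, sub_mul, Finset.sum_sub_distrib]
    rw [Finset.sum_comm (f := fun a b => gamC a b * X b a)]
  have h2 : ∀ a b : Fin (n + 1), gamC a b - gamC b a =
      eBar a * eHat b - if a = b then (1 : Cl n) else 0 := by
    intro a b
    rcases lt_trichotomy a b with h | rfl | h
    · simp [gamC, h, h.not_gt, h.ne]
    · simp [eBar_mul_eHat_self]
    · have := eBar_mul_eHat_add a b
      rw [if_neg h.ne'] at this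
      simp [gamC, h, h.not_gt, h.ne', eq_neg_of_add_eq_zero_left this]
  rw [h1]
  simp [h2, sub_mul, Finset.sum_sub_distrib]

/-- This is `Γ₀ x̄ = n x̄`: the full sum gives `(n + 1) x̄` since `e_b ē_b = 1`, and the diagonal
removes one copy. -/
theorem sum_gamC_mul_parBar_rotVec (x : E n) :
    ∑ a, ∑ b, gamC a b * parBar (rotVec a b x) = (n : ℝ) • parBar x := by
  have h : ∀ a b : Fin (n + 1), parBar (rotVec a b x) = x a • eBar b - x b • eBar a := by
    intro a b
    rw [rotVec, parBar_sub, ← parBarCL_apply, ← parBarCL_apply, map_smul, map_smul, parBarCL_apply,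
      parBarCL_apply, parBar_eq_sum, parBar_eq_sum]
    simp
  simp only [h]
  rw [sum_gamC_mul_sub fun a b => x a • eBar b, parBar_eq_sum]
  simp only [mul_smul_comm, mul_assoc, eHat_mul_eBar_self, mul_one, Finset.sum_const,
    Finset.card_univ, Fintype.card_fin]
  rw [← Finset.smul_sum, ← Nat.cast_smul_eq_nsmul ℝ]
  push_cast
  module

/-- This is `Γ₀` applied to the linear function `⟨y, ·⟩`, the second ingredient in differentiating
the kernel. -/
theorem sum_gamC_mul_inner_rotVec (x y : E n) :
    ∑ a, ∑ b, inner ℝ y (rotVec a b x) • gamC a b = parBar x * par y - inner ℝ x y • (1 : Cl n) := by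
  have h : ∀ a b : Fin (n + 1), inner ℝ y (rotVec a b x) • gamC a b =
      gamC a b * ((x a * y b) • (1 : Cl n) - (x b * y a) • (1 : Cl n)) := by
    intro a b
    rw [← sub_smul, mul_smul_comm, mul_one, rotVec, inner_sub_right, inner_smul_right,
      inner_smul_right]
    simp [EuclideanSpace.inner_single_right]
  simp only [h]
  rw [sum_gamC_mul_sub fun a b => (x a * y b) • (1 : Cl n), par_eq_sum, parBar_eq_sum,
    Finset.sum_mul_sum, ← Finset.sum_smul]
  congr 1
  · refine Finset.sum_congr rfl fun a _ => Finset.sum_congr rfl fun b _ => ?_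
    rw [smul_mul_smul_comm, mul_smul_comm, mul_one]
  · congr 1
    simp [PiLp.inner_apply, mul_comm]

end Clifford

/-! ### The regularized kernel under `Γ₀ - n/2` -/

section Kernel

variable {n : ℕ} {V : Type*} [NormedAddCommGroup V] [NormedSpace ℝ V]

theorem inner_rotVec_self (a b : Fin (n + 1)) (x : E n) : inner ℝ x (rotVec a b x) = 0 := by
  simp [rotVec, inner_sub_right, inner_smul_right, EuclideanSpace.inner_single_right, mul_comm]

theorem rotVec_self (a : Fin (n + 1)) (x : E n) : rotVec a a x = 0 := sub_self _

theorem rotDeriv_self (a : Fin (n + 1)) (f : Sph n → V) (w : Sph n) : rotDeriv a a f w = 0 := by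
  rw [rotDeriv_eq, rotVec_self, map_zero]

/-- The rotation fields are tangent to the sphere, so the derivative of the radial projection at `w`
fixes them, and the extension along rays may be replaced by `g` itself. -/
theorem rotDeriv_restrict {g : E n → V} {w : Sph n} (hg : DifferentiableAt ℝ g w)
    (a b : Fin (n + 1)) :
    rotDeriv a b (fun w => g w) w = fderiv ℝ g w (rotVec a b w) := by
  have hw := norm_sphere w
  -- Writing the norm as `√(‖x‖ ^ 2)` reduces its derivative to that of the squared norm.
  set N : E n → E n := fun x => (√(‖x‖ ^ 2))⁻¹ • x with hN
  have hNw : N w = w := by simp [hN]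
  have h1 : homExt (fun w : Sph n => g w) =ᶠ[𝓝 (w : E n)] g ∘ N := by
    filter_upwards [isOpen_ne.mem_nhds (sphere_ne_zero w)] with y hy
    rw [homExt_of_ne _ hy]
    simp [hN, radProj]
  have h2 := ((hasDerivAt_inv (by simp)).comp_hasFDerivAt (w : E n)
    ((hasStrictFDerivAt_norm_sq (w : E n)).hasFDerivAt.sqrt (by simp))).smul
      (hasFDerivAt_id (w : E n))
  have h3 : HasFDerivAt g (fderiv ℝ g w) (N w) := by rw [hNw]; exact hg.hasFDerivAt
  have h4 := h3.comp (w : E n) h2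
  rw [rotDeriv_eq, h1.fderiv_eq]
  erw [h4.fderiv]
  simp [inner_rotVec_self]

/-- The regularization of the fundamental solution with pole at `v`. -/
def gReg (ε : ℝ) (v : Sph n) (x : E n) : Cl n :=
  (area n * √(‖x - v‖ ^ 2 + ε ^ 2) ^ n)⁻¹ • parBar (x - (v : E n))

theorem contDiff_gReg (hn : 1 ≤ n) {ε : ℝ} (hε : 0 < ε) (v : Sph n) :
    ContDiff ℝ 1 (gReg ε v) := by
  have hA := area_pos hn
  unfold gReg
  simp only [← parBarCL_apply]
  refine ContDiff.smul (ContDiff.inv (contDiff_const.mul (ContDiff.pow (ContDiff.sqrt ?_ ?_) n)) ?_)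
    ((parBarCL n).contDiff.comp (contDiff_id.sub contDiff_const))
  · exact ((contDiff_id.sub contDiff_const).norm_sq ℝ).add contDiff_const
  · intro x; positivity
  · intro x
    have := sqrt_sq_add_sq_pos hε ‖x - v‖
    positivity

theorem fderiv_gReg (hn : 1 ≤ n) {ε : ℝ} (hε : 0 < ε) (v : Sph n) (x τ : E n) :
    fderiv ℝ (gReg ε v) x τ = (area n * √(‖x - v‖ ^ 2 + ε ^ 2) ^ n)⁻¹ • parBar τ -
      (n * inner ℝ (x - v) τ / (area n * √(‖x - v‖ ^ 2 + ε ^ 2) ^ (n + 2))) • parBar (x - (v : E n)) := by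
  have hA := area_pos hn
  have hR := sqrt_sq_add_sq_pos hε ‖x - v‖
  have hl : HasDerivAt (fun t : ℝ => x - v + t • τ) τ 0 := by
    simpa using ((hasDerivAt_id (0 : ℝ)).smul_const τ).const_add (x - v)
  have h1 : HasDerivAt (fun t : ℝ => gReg ε v (x + t • τ)) (fderiv ℝ (gReg ε v) x τ) 0 := by
    have hd := ((contDiff_gReg hn hε v).differentiable one_ne_zero x).hasFDerivAt
    have hl' : HasDerivAt (fun t : ℝ => x + t • τ) τ 0 := by
      simpa using ((hasDerivAt_id (0 : ℝ)).smul_const τ).const_add x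
    have hx : x = x + (0 : ℝ) • τ := by simp
    rw [hx] at hd
    have := hd.comp_hasDerivAt (0 : ℝ) hl'
    rwa [← hx] at this
  have h2 := ((hl.norm_sq.add_const (ε ^ 2)).sqrt (by simp; positivity))
  have h3 := (((h2.pow n).const_mul (area n)).inv
    (by simp only [Pi.pow_apply, zero_smul, add_zero]; positivity)).smul
    ((parBarCL n).hasFDerivAt.comp_hasDerivAt (0 : ℝ) hl)
  have h4 : (fun t : ℝ => gReg ε v (x + t • τ)) = fun t : ℝ =>
      (area n * √(‖x - v + t • τ‖ ^ 2 + ε ^ 2) ^ n)⁻¹ • parBarCL n (x - v + t • τ) := by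
    funext t
    rw [gReg, parBarCL_apply, add_sub_right_comm]
  rw [h4] at h1
  have h5 := h1.unique h3
  rw [h5]
  simp only [zero_smul, add_zero, parBarCL_apply, Pi.inv_apply, Pi.pow_apply, Function.comp_apply]
  rw [sub_eq_add_neg (_ • parBar τ), ← neg_smul]
  generalize √(‖x - v‖ ^ 2 + ε ^ 2) = R at *
  congr 2
  obtain ⟨m, rfl⟩ : ∃ m, n = m + 1 := ⟨n - 1, by omega⟩
  rw [Nat.add_sub_cancel]
  field_simp
  ring

/-- With `s = ⟨w, v⟩`, the relations `w̄ v + v̄ w = 2s` and `w w̄ = v v̄ = 1` give `w̄ v w̄ = 2s w̄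
- v̄` and `w̄ v v̄ = w̄`. Everything collapses to `(s - 1)(w̄ + v̄)`, and `1 - s = ‖w - v‖² / 2`. -/
theorem parBar_mul_par_sub_mul (w v : Sph n) :
    (parBar (w : E n) * par (v : E n) - inner ℝ (w : E n) (v : E n) • (1 : Cl n)) *
      parBar ((w : E n) - (v : E n)) =
      -(‖(w : E n) - v‖ ^ 2 / 2) • (parBar (w : E n) + parBar (v : E n)) := by
  have h1 := parBar_mul_par_add (w : E n) (v : E n)
  have h2 := par_mul_parBar_sphere w
  have h3 := par_mul_parBar_sphere v
  rw [norm_sub_sq_sphere, parBar_sub]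
  generalize inner ℝ (w : E n) (v : E n) = s at *
  generalize parBar (w : E n) = wb at *
  generalize par (w : E n) = w' at *
  generalize parBar (v : E n) = vb at *
  generalize par (v : E n) = v' at *
  have h4 : wb * v' * wb = (2 * s) • wb - vb := by
    rw [eq_sub_of_add_eq h1, sub_mul, mul_assoc, h2, smul_mul_assoc, one_mul, mul_one]
  have h5 : wb * v' * vb = wb := by rw [mul_assoc, h3, mul_one]
  rw [sub_mul, mul_sub, h4, h5, smul_mul_assoc, one_mul]
  module

/-- Differentiating the numerator gives `n w̄ / (σ Rⁿ)`; subtracting `n/2` times the kernel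
symmetrizes it to `n (w̄ + v̄) / (2σ Rⁿ)`. Differentiating the denominator contributes the same
expression times `-‖w - v‖² / R²`, and `R² - ‖w - v‖² = ε²` remains. -/
theorem Gam_gReg (hn : 1 ≤ n) {ε : ℝ} (hε : 0 < ε) (v w : Sph n) :
    Gam (fun w => gReg ε v w) w - ((n : ℝ) / 2) • gReg ε v w =
      (peakKer ε v w / 2) • (parBar (w : E n) + parBar (v : E n)) := by
  have hA := area_pos hn
  have hR := sqrt_sq_add_sq_pos hε ‖(w : E n) - v‖
  have hsq := Real.sq_sqrt (show 0 ≤ ‖(w : E n) - v‖ ^ 2 + ε ^ 2 by positivity)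
  have h1 : ∀ a b : Fin (n + 1), rotDeriv a b (fun w => gReg ε v w) w =
      (area n * √(‖(w : E n) - v‖ ^ 2 + ε ^ 2) ^ n)⁻¹ • parBar (rotVec a b (w : E n)) +
      (n / (area n * √(‖(w : E n) - v‖ ^ 2 + ε ^ 2) ^ (n + 2)) *
        inner ℝ (v : E n) (rotVec a b w)) • parBar ((w : E n) - (v : E n)) := by
    intro a b
    rw [rotDeriv_restrict ((contDiff_gReg hn hε v).differentiable one_ne_zero w),
      fderiv_gReg hn hε, inner_sub_left, inner_rotVec_self, zero_sub, sub_eq_add_neg, ← neg_smul]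
    congr 2
    ring
  have h2 : ∀ a b : Fin (n + 1), gamC a b * rotDeriv a b (fun w => gReg ε v w) w =
      (area n * √(‖(w : E n) - v‖ ^ 2 + ε ^ 2) ^ n)⁻¹ • (gamC a b * parBar (rotVec a b (w : E n))) +
      (n / (area n * √(‖(w : E n) - v‖ ^ 2 + ε ^ 2) ^ (n + 2))) •
        ((inner ℝ (v : E n) (rotVec a b w) • gamC a b) * parBar ((w : E n) - (v : E n))) := by
    intro a b
    rw [h1, mul_add, mul_smul_comm, mul_smul_comm, smul_mul_assoc, mul_smul]
  rw [Gam_eq_angOp, angOp]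
  simp only [h2, Finset.sum_add_distrib, ← Finset.smul_sum, ← Finset.sum_mul]
  rw [sum_gamC_mul_parBar_rotVec, sum_gamC_mul_inner_rotVec, parBar_mul_par_sub_mul, gReg, peakKer,
    parBar_sub]
  generalize √(‖(w : E n) - v‖ ^ 2 + ε ^ 2) = R at *
  generalize ‖(w : E n) - v‖ = r at *
  have hr : r ^ 2 = R ^ 2 - ε ^ 2 := by rw [hsq]; ring
  rw [hr]
  match_scalars <;> field_simp <;> ring

theorem rotDeriv_algebraMap {ψ : Sph n → ℝ} {w : Sph n} (hψ : DifferentiableAt ℝ (homExt ψ) w)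
    (a b : Fin (n + 1)) :
    rotDeriv a b (fun v => algebraMap ℝ (Cl n) (ψ v)) w = rotDeriv a b ψ w • (1 : Cl n) := by
  have := rotDeriv_clm ((1 : ℝ →L[ℝ] ℝ).smulRight (1 : Cl n)) hψ a b
  simpa [Algebra.algebraMap_eq_smul_one] using this

theorem angOp_algebraMap_mul (c : Fin (n + 1) → Fin (n + 1) → Cl n) {ψ : Sph n → ℝ} {w : Sph n}
    (hψ : DifferentiableAt ℝ (homExt ψ) w) (x : Cl n) :
    angOp c (fun v => algebraMap ℝ (Cl n) (ψ v)) w * x =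
      ∑ a, ∑ b, c a b * (rotDeriv a b ψ w • x) := by
  simp only [angOp, Finset.sum_mul, rotDeriv_algebraMap hψ]
  simp

/-- Integration by parts for the operators `∑ c_{ab} (x_a ∂_b - x_b ∂_a)`. -/
theorem integral_smul_angOp (c : Fin (n + 1) → Fin (n + 1) → Cl n) {Ω : Set (Sph n)}
    (hΩ : IsOpen Ω) {ψ : Sph n → ℝ} (hψ : CkOn 1 ψ univ) (hs : tsupport ψ ⊆ Ω)
    {u : Sph n → Cl n} (hu : CkOn 1 u Ω) :
    ∫ w in Ω, ψ w • angOp c u w ∂surf n =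
      -∫ w in Ω, angOp c (fun v => algebraMap ℝ (Cl n) (ψ v)) w * u w ∂surf n := by
  have hi1 : ∀ a b, Integrable (fun w => ψ w • rotDeriv a b u w) ((surf n).restrict Ω) :=
    fun a b => integrable_smul_of_tsupport hψ.continuous hs
      ((hu.continuousOn_rotDeriv hΩ a b).locallyIntegrableOn hΩ.measurableSet)
  have hi2 : ∀ a b, Integrable (fun w => rotDeriv a b ψ w • u w) ((surf n).restrict Ω) :=
    fun a b => integrable_smul_of_tsupport (continuousOn_univ.1
      (hψ.continuousOn_rotDeriv isOpen_univ a b)) ((tsupport_rotDeriv_subset ψ a b).trans hs)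
      (hu.continuousOn.locallyIntegrableOn hΩ.measurableSet)
  have h1 : ∀ w, angOp c (fun v => algebraMap ℝ (Cl n) (ψ v)) w * u w =
      ∑ a, ∑ b, mulCL n (c a b) (rotDeriv a b ψ w • u w) := fun w =>
    angOp_algebraMap_mul c (hψ.differentiableAt isOpen_univ (mem_univ w)) (u w)
  have h2 : ∀ w, ψ w • angOp c u w = ∑ a, ∑ b, mulCL n (c a b) (ψ w • rotDeriv a b u w) := by
    intro w
    simp only [angOp, Finset.smul_sum, mulCL_apply, mul_smul_comm]
  simp only [h1, h2]
  have hj1 := fun a b => (mulCL n (c a b)).integrable_comp (hi1 a b)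
  have hj2 := fun a b => (mulCL n (c a b)).integrable_comp (hi2 a b)
  rw [integral_finsetSum _ fun a _ => integrable_finsetSum _ fun b _ => hj1 a b,
    integral_finsetSum _ fun a _ => integrable_finsetSum _ fun b _ => hj2 a b,
    ← Finset.sum_neg_distrib]
  refine Finset.sum_congr rfl fun a _ => ?_
  rw [integral_finsetSum _ fun b _ => hj1 a b, integral_finsetSum _ fun b _ => hj2 a b,
    ← Finset.sum_neg_distrib]
  refine Finset.sum_congr rfl fun b _ => ?_
  rw [ContinuousLinearMap.integral_comp_comm _ (hi1 a b),
    ContinuousLinearMap.integral_comp_comm _ (hi2 a b), ← map_neg]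
  congr 1
  by_cases hab : a = b
  · subst hab
    simp [rotDeriv_self]
  · exact integral_smul_rotDeriv hΩ hψ hs hu hab

end Kernel

/-! ### The fundamental solution and the Cauchy transform -/

section Cauchy

variable {n : ℕ}

theorem Gs_eq_gReg (w v : Sph n) : Gs w v = gReg 0 v w := by
  rw [Gs, gReg, zero_pow two_ne_zero, add_zero, Real.sqrt_sq (norm_nonneg _)]

/-- Since `R ≥ ‖w - v‖`, the bound is uniform in `ε` and serves as the dominating function in the
limit `ε → 0`. -/
theorem norm_gReg_le (hn : 1 ≤ n) (ε : ℝ) (v w : Sph n) :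
    ‖gReg ε v w‖ ≤ ‖parBarCL n‖ / area n * (‖(w : E n) - v‖ ^ (n - 1))⁻¹ := by
  have hA := area_nonneg n
  have h1 : ‖parBar ((w : E n) - (v : E n))‖ ≤ ‖parBarCL n‖ * ‖(w : E n) - v‖ := by
    rw [← parBarCL_apply]
    exact (parBarCL n).le_opNorm _
  have h2 := le_sqrt_sq_add_sq ε ‖(w : E n) - v‖
  rw [gReg, norm_smul, norm_inv, Real.norm_of_nonneg (by positivity)]
  have hr0 := norm_nonneg ((w : E n) - v)
  generalize √(‖(w : E n) - v‖ ^ 2 + ε ^ 2) = R at *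
  generalize ‖(w : E n) - v‖ = r at *
  generalize ‖parBar ((w : E n) - (v : E n))‖ = y at *
  have hM := norm_nonneg (parBarCL n)
  generalize ‖parBarCL n‖ = M at *
  have h3 : (R ^ n)⁻¹ * r ≤ (r ^ (n - 1))⁻¹ := by
    rcases hr0.eq_or_lt with rfl | hr
    · simp
    · have hR := hr.trans_le h2
      rw [inv_mul_le_iff₀ (by positivity), ← div_eq_mul_inv, le_div_iff₀ (by positivity)]
      calc r * r ^ (n - 1) = r ^ n := by rw [← pow_succ', Nat.sub_add_cancel hn]
        _ ≤ R ^ n := by gcongr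
  calc (area n * R ^ n)⁻¹ * y ≤ (area n * R ^ n)⁻¹ * (M * r) := by
        have : 0 ≤ R := hr0.trans h2
        gcongr
    _ = M / area n * ((R ^ n)⁻¹ * r) := by rw [mul_inv, div_eq_mul_inv]; ring
    _ ≤ M / area n * (r ^ (n - 1))⁻¹ := by gcongr

theorem norm_Gs_le (hn : 1 ≤ n) (w v : Sph n) :
    ‖Gs w v‖ ≤ ‖parBarCL n‖ / area n * (‖(w : E n) - v‖ ^ (n - 1))⁻¹ := by
  rw [Gs_eq_gReg]
  exact norm_gReg_le hn 0 v w

theorem tendsto_gReg (hn : 1 ≤ n) (v w : Sph n) :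
    Tendsto (fun ε => gReg ε v (w : E n)) (𝓝[>] 0) (𝓝 (Gs w v)) := by
  rw [Gs_eq_gReg]
  by_cases h : w = v
  · subst h
    have h0 : ∀ ε, gReg ε w (w : E n) = 0 := fun ε => by
      rw [gReg, sub_self, ← parBarCL_apply, map_zero, smul_zero]
    simp only [h0]
    exact tendsto_const_nhds
  · have hne : (w : E n) - v ≠ 0 := sub_ne_zero.2 fun h' => h (Subtype.ext h')
    have hA := area_pos hn
    refine Tendsto.mono_left (ContinuousAt.tendsto ?_) nhdsWithin_le_nhds
    unfold gReg
    have hc : Continuous fun ε : ℝ => area n * √(‖(w : E n) - v‖ ^ 2 + ε ^ 2) ^ n := by fun_prop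
    refine ContinuousAt.smul (ContinuousAt.inv₀ hc.continuousAt ?_) continuousAt_const
    have : 0 < √(‖(w : E n) - v‖ ^ 2 + 0 ^ 2) := Real.sqrt_pos.2 (by positivity)
    positivity

theorem stronglyMeasurable_Gs :
    StronglyMeasurable fun p : Sph n × Sph n => Gs p.1 p.2 := by
  unfold Gs
  have h : Measurable fun p : Sph n × Sph n => (area n * ‖(p.1 : E n) - p.2‖ ^ n)⁻¹ := by fun_prop
  refine h.stronglyMeasurable.smul ?_
  exact (continuous_parBar.comp (by fun_prop)).stronglyMeasurable

theorem continuous_angOp_algebraMap (c : Fin (n + 1) → Fin (n + 1) → Cl n) {ψ : Sph n → ℝ}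
    (hψ : CkOn 1 ψ univ) : Continuous (angOp c fun v => algebraMap ℝ (Cl n) (ψ v)) := by
  have h : (angOp c fun v => algebraMap ℝ (Cl n) (ψ v)) = fun w =>
      ∑ a, ∑ b, c a b * (rotDeriv a b ψ w • (1 : Cl n)) := by
    funext w
    rw [← angOp_algebraMap_mul c (hψ.differentiableAt isOpen_univ (mem_univ w)), mul_one]
  have hr : ∀ a b, Continuous (rotDeriv a b ψ) := fun a b =>
    continuousOn_univ.1 (hψ.continuousOn_rotDeriv isOpen_univ a b)
  have hr' : ∀ a b, Continuous fun w => rotDeriv a b ψ w • (1 : Cl n) := fun a b => by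
    have := hr a b
    fun_prop
  rw [h]
  exact continuous_finsetSum _ fun a _ => continuous_finsetSum _ fun b _ =>
    continuous_const.mul (hr' a b)

theorem angOp_algebraMap_eq_zero (c : Fin (n + 1) → Fin (n + 1) → Cl n) {ψ : Sph n → ℝ}
    (hψ : CkOn 1 ψ univ) {w : Sph n} (hw : w ∉ tsupport ψ) :
    angOp c (fun v => algebraMap ℝ (Cl n) (ψ v)) w = 0 := by
  rw [← mul_one (angOp c _ w),
    angOp_algebraMap_mul c (hψ.differentiableAt isOpen_univ (mem_univ w))]
  simp [rotDeriv_eq_zero_of_notMem hw]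

/-- The transpose of `Γ₀ - n/2`, up to sign, applied to a scalar function. -/
def testOp (ψ : Sph n → ℝ) (w : Sph n) : Cl n :=
  angOp gamC (fun v => algebraMap ℝ (Cl n) (ψ v)) w + ((n : ℝ) / 2 * ψ w) • (1 : Cl n)

theorem continuous_testOp {ψ : Sph n → ℝ} (hψ : CkOn 1 ψ univ) : Continuous (testOp ψ) := by
  have := hψ.continuous
  exact (continuous_angOp_algebraMap gamC hψ).add (by fun_prop)

theorem testOp_eq_zero {ψ : Sph n → ℝ} (hψ : CkOn 1 ψ univ) {w : Sph n} (hw : w ∉ tsupport ψ) :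
    testOp ψ w = 0 := by
  rw [testOp, angOp_algebraMap_eq_zero gamC hψ hw, image_eq_zero_of_notMem_tsupport hw]
  simp

theorem exists_norm_testOp_le {ψ : Sph n → ℝ} (hψ : CkOn 1 ψ univ) :
    ∃ C, 0 ≤ C ∧ ∀ w, ‖testOp ψ w‖ ≤ C := by
  obtain ⟨C, hC⟩ := (isCompact_univ (X := Sph n)).exists_bound_of_continuousOn
    (continuous_testOp hψ).continuousOn
  exact ⟨max C 0, le_max_right _ _, fun w => (hC w (mem_univ w)).trans (le_max_left _ _)⟩

/-- Integration by parts turns `Γ₀ + n/2` on `ψ` into `-(Γ₀ - n/2)` on the kernel, where `Gam_gReg`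
applies. -/
theorem integral_testOp_mul_gReg (hn : 1 ≤ n) {ψ : Sph n → ℝ} (hψ : CkOn 1 ψ univ) {ε : ℝ}
    (hε : 0 < ε) (v : Sph n) :
    ∫ w : Sph n, testOp ψ w * gReg ε v w ∂surf n =
      -∫ w : Sph n, peakKer ε v w •
        ((ψ w / 2) • (parBar (w : E n) + parBar (v : E n))) ∂surf n := by
  have hg : CkOn 1 (fun w : Sph n => gReg ε v w) univ :=
    ckOn_restrict fun w _ => (contDiff_gReg hn hε v).contDiffAt
  have hibp := integral_smul_angOp gamC isOpen_univ hψ (subset_univ _) hg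
  have hψc := hψ.continuous
  have hgc := hg.continuous
  have hint : ∀ {F : Sph n → Cl n}, Continuous F → Integrable F (surf n) := fun hF =>
    hF.integrable_of_hasCompactSupport (HasCompactSupport.of_compactSpace _)
  simp only [Measure.restrict_univ] at hibp
  have hac : Continuous (angOp gamC fun w : Sph n => gReg ε v w) := by
    have hr : ∀ a b, Continuous (rotDeriv a b fun w : Sph n => gReg ε v w) := fun a b =>
      continuousOn_univ.1 (hg.continuousOn_rotDeriv isOpen_univ a b)
    exact continuous_finsetSum _ fun a _ => continuous_finsetSum _ fun b _ =>
      continuous_const.mul (hr a b)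
  have h1 : ∀ w : Sph n, peakKer ε v w • ((ψ w / 2) • (parBar (w : E n) + parBar (v : E n))) =
      ψ w • angOp gamC (fun w : Sph n => gReg ε v w) w - (n / 2 * ψ w) • gReg ε v w := by
    intro w
    have := Gam_gReg hn hε v w
    rw [Gam_eq_angOp] at this
    rw [sub_eq_iff_eq_add.1 this]
    module
  have h2 : ∀ w : Sph n, testOp ψ w * gReg ε v w =
      angOp gamC (fun v => algebraMap ℝ (Cl n) (ψ v)) w * gReg ε v w +
        (n / 2 * ψ w) • gReg ε v w := by
    intro w
    rw [testOp, add_mul, smul_mul_assoc, one_mul]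
  simp only [h1, h2]
  rw [integral_add, integral_sub, hibp]
  · abel
  · exact hint (hψc.smul hac)
  · exact hint (by fun_prop)
  · exact hint ((continuous_angOp_algebraMap gamC hψ).mul hgc)
  · exact hint (by fun_prop)

theorem integrable_mul_Gs (hn : 1 ≤ n) {k : Sph n → Cl n} (hk : Continuous k) (v : Sph n) :
    Integrable (fun w => k w * Gs w v) (surf n) := by
  obtain ⟨C, hC⟩ := (isCompact_univ (X := Sph n)).exists_bound_of_continuousOn hk.continuousOn
  refine Integrable.mono' (((integrable_inv_pow_norm_sub hn v).const_mul
    (‖parBarCL n‖ / area n)).const_mul (‖mulCL n‖ * C))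
    ((mulCL n).aestronglyMeasurable_comp₂ hk.aestronglyMeasurable ?_) (ae_of_all _ fun w => ?_)
  · exact (stronglyMeasurable_Gs.comp_measurable
      (measurable_prodMk_right (y := v))).aestronglyMeasurable
  · refine (norm_mul_le_mulCL _ _).trans ?_
    have h1 := norm_Gs_le hn w v
    have h2 := hC w (mem_univ w)
    have h3 : 0 ≤ C := (norm_nonneg _).trans h2
    gcongr

/-- `D_s G_s = δ`. -/
theorem integral_testOp_mul_Gs (hn : 1 ≤ n) {ψ : Sph n → ℝ} (hψ : CkOn 1 ψ univ) (v : Sph n) :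
    ∫ w : Sph n, testOp ψ w * Gs w v ∂surf n = -(ψ v • parBar (v : E n)) := by
  have hψc := hψ.continuous
  have h1 : Tendsto (fun ε => ∫ w : Sph n, testOp ψ w * gReg ε v w ∂surf n) (𝓝[>] 0)
      (𝓝 (∫ w : Sph n, testOp ψ w * Gs w v ∂surf n)) := by
    obtain ⟨C, hC0, hC⟩ := exists_norm_testOp_le hψ
    refine tendsto_integral_filter_of_dominated_convergence
      (fun w => ‖mulCL n‖ * C * (‖parBarCL n‖ / area n * (‖(w : E n) - v‖ ^ (n - 1))⁻¹)) ?_ ?_ ?_ ?_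
    · filter_upwards [self_mem_nhdsWithin] with ε hε
      exact ((continuous_testOp hψ).mul ((contDiff_gReg hn hε v).continuous.comp
        continuous_subtype_val)).aestronglyMeasurable
    · refine Eventually.of_forall fun ε => ae_of_all _ fun w => ?_
      refine (norm_mul_le_mulCL _ _).trans ?_
      have h1 := norm_gReg_le hn ε v w
      have h2 := hC w
      gcongr
    · exact ((integrable_inv_pow_norm_sub hn v).const_mul _).const_mul _
    · exact ae_of_all _ fun w => tendsto_const_nhds.mul (tendsto_gReg hn v w)
  -- At `w = v` the continuous factor `(ψ w / 2)(w̄ + v̄)` takes the value `ψ v • v̄`.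
  have h2 := (tendsto_integral_peakKer_smul hn v (g := fun w : Sph n =>
    (ψ w / 2) • (parBar (w : E n) + parBar (v : E n))) (by
      have := continuous_parBar (n := n)
      fun_prop)).neg
  have h3 : Tendsto (fun ε => ∫ w : Sph n, testOp ψ w * gReg ε v w ∂surf n) (𝓝[>] 0)
      (𝓝 (-((ψ v / 2) • (parBar (v : E n) + parBar (v : E n))))) := by
    refine h2.congr' ?_
    filter_upwards [self_mem_nhdsWithin] with ε hε
    exact (integral_testOp_mul_gReg hn hψ hε v).symm
  rw [tendsto_nhds_unique h1 h3]
  module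

theorem integral_inv_pow_norm_sub_le (hn : 1 ≤ n) {μ : Measure (Sph n)} (hμ : μ ≤ surf n)
    (v : Sph n) : ∫ w : Sph n, (‖(w : E n) - v‖ ^ (n - 1))⁻¹ ∂μ ≤ area n * Real.pi := by
  have h0 := area_nonneg n
  refine (integral_mono_measure hμ (ae_of_all _ fun w => by positivity)
    (integrable_inv_pow_norm_sub hn v)).trans ?_
  rw [integral_eq_lintegral_of_nonneg_ae (ae_of_all _ fun w => by positivity)
    (integrable_inv_pow_norm_sub hn v).1]
  exact ENNReal.toReal_le_of_le_ofReal (by positivity) (lintegral_inv_pow_norm_sub_le hn v)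

/-- Tonelli: integrating first in `w`, the kernel contributes at most a constant independent of `v`,
and `‖h‖` is integrable. -/
theorem integrable_Gs_mul (hn : 1 ≤ n) {μ : Measure (Sph n)} (hμ : μ ≤ surf n) {h : Sph n → Cl n}
    (hh : Integrable h μ) :
    Integrable (fun p : Sph n × Sph n => Gs p.1 p.2 * h p.2) (μ.prod μ) := by
  have : IsFiniteMeasure μ := isFiniteMeasure_of_le _ hμ
  have hD : Integrable (fun p : Sph n × Sph n =>
      (‖(p.1 : E n) - p.2‖ ^ (n - 1))⁻¹ * ‖h p.2‖) (μ.prod μ) := by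
    have hm : AEStronglyMeasurable (fun p : Sph n × Sph n =>
        (‖(p.1 : E n) - p.2‖ ^ (n - 1))⁻¹ * ‖h p.2‖) (μ.prod μ) :=
      (Measurable.aestronglyMeasurable (by fun_prop)).mul hh.1.norm.comp_snd
    rw [integrable_prod_iff' hm]
    refine ⟨ae_of_all _ fun v =>
      ((integrable_inv_pow_norm_sub hn v).mono_measure hμ).mul_const ‖h v‖, ?_⟩
    refine Integrable.mono' (hh.norm.const_mul (area n * Real.pi))
      hm.norm.prod_swap.integral_prod_right' (ae_of_all _ fun v => ?_)
    have h1 : ∀ w : Sph n, ‖(‖(w : E n) - v‖ ^ (n - 1))⁻¹ * ‖h v‖‖ =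
        (‖(w : E n) - v‖ ^ (n - 1))⁻¹ * ‖h v‖ := fun w => Real.norm_of_nonneg (by positivity)
    simp only [h1]
    rw [Real.norm_of_nonneg (integral_nonneg fun w => by positivity), integral_mul_const]
    gcongr
    exact integral_inv_pow_norm_sub_le hn hμ v
  refine Integrable.mono' (hD.const_mul (‖mulCL n‖ * (‖parBarCL n‖ / area n)))
    ((mulCL n).aestronglyMeasurable_comp₂ stronglyMeasurable_Gs.aestronglyMeasurable
      hh.1.comp_snd) (ae_of_all _ fun p => ?_)
  refine (norm_mul_le_mulCL _ _).trans ?_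
  have h1 := norm_Gs_le hn p.1 p.2
  calc _ ≤ ‖mulCL n‖ * (‖parBarCL n‖ / area n * (‖(p.1 : E n) - p.2‖ ^ (n - 1))⁻¹) * ‖h p.2‖ := by
        gcongr
    _ = _ := by ring

theorem integrable_T (hn : 1 ≤ n) {Ω : Set (Sph n)} {h : Sph n → Cl n}
    (hh : Integrable h ((surf n).restrict Ω)) : Integrable (T Ω h) ((surf n).restrict Ω) :=
  (integrable_Gs_mul hn Measure.restrict_le_self hh).integral_prod_left

/-- Only almost everywhere: Fubini makes the integrals defining `T Ω h` and `T Ω h'` converge for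
almost every `w`. -/
theorem T_sub (hn : 1 ≤ n) {Ω : Set (Sph n)} {h h' : Sph n → Cl n}
    (hh : Integrable h ((surf n).restrict Ω)) (hh' : Integrable h' ((surf n).restrict Ω)) :
    T Ω (h - h') =ᵐ[(surf n).restrict Ω] T Ω h - T Ω h' := by
  filter_upwards [(integrable_Gs_mul hn Measure.restrict_le_self hh).prod_right_ae,
    (integrable_Gs_mul hn Measure.restrict_le_self hh').prod_right_ae] with w hw hw'
  simp only [T, Pi.sub_apply, mul_sub]
  exact integral_sub hw hw'

theorem T_congr {Ω : Set (Sph n)} {h h' : Sph n → Cl n} (hh : h =ᵐ[(surf n).restrict Ω] h') :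
    T Ω h = T Ω h' := by
  funext w
  refine integral_congr_ae ?_
  filter_upwards [hh] with v hv
  rw [hv]

/-- After Fubini the inner integral is the action of the fundamental solution on `ψ`; it extends
from `Ω` to the sphere because `testOp ψ` vanishes off `tsupport ψ`. -/
theorem setIntegral_testOp_mul_T (hn : 1 ≤ n) {Ω : Set (Sph n)} {h : Sph n → Cl n}
    (hh : Integrable h ((surf n).restrict Ω)) {ψ : Sph n → ℝ} (hψ : CkOn 1 ψ univ)
    (hs : tsupport ψ ⊆ Ω) :
    ∫ w in Ω, testOp ψ w * T Ω h w ∂surf n =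
      -∫ v in Ω, ψ v • (parBar (v : E n) * h v) ∂surf n := by
  have hF := integrable_Gs_mul hn (Measure.restrict_le_self (s := Ω)) hh
  obtain ⟨C, hC0, hC⟩ := exists_norm_testOp_le hψ
  have hkF : Integrable (fun p : Sph n × Sph n => testOp ψ p.1 * (Gs p.1 p.2 * h p.2))
      (((surf n).restrict Ω).prod ((surf n).restrict Ω)) := by
    refine Integrable.mono' (hF.norm.const_mul (‖mulCL n‖ * C))
      ((mulCL n).aestronglyMeasurable_comp₂
        ((continuous_testOp hψ).comp continuous_fst).aestronglyMeasurable hF.1)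
      (ae_of_all _ fun p => (norm_mul_le_mulCL _ _).trans ?_)
    have := hC p.1
    gcongr
  calc ∫ w in Ω, testOp ψ w * T Ω h w ∂surf n
      = ∫ w in Ω, ∫ v in Ω, testOp ψ w * (Gs w v * h v) ∂surf n ∂surf n := by
        refine integral_congr_ae ?_
        filter_upwards [hF.prod_right_ae] with w hw
        exact ((mulCL n (testOp ψ w)).integral_comp_comm hw).symm
    _ = ∫ v in Ω, ∫ w in Ω, testOp ψ w * (Gs w v * h v) ∂surf n ∂surf n :=
        integral_integral_swap hkF
    _ = ∫ v in Ω, -(ψ v • (parBar (v : E n) * h v)) ∂surf n := by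
        refine integral_congr_ae (ae_of_all _ fun v => ?_)
        have h1 := integrable_mul_Gs hn (continuous_testOp hψ) v
        have h2 := ((mulCL n).flip (h v)).integral_comp_comm (h1.mono_measure
          (Measure.restrict_le_self (s := Ω)))
        have h3 : ∫ w in Ω, testOp ψ w * Gs w v ∂surf n = -(ψ v • parBar (v : E n)) := by
          rw [← integral_testOp_mul_Gs hn hψ v]
          exact setIntegral_eq_integral_of_tsupport hs fun w hw => by
            rw [testOp_eq_zero hψ hw, zero_mul]
        simp only [ContinuousLinearMap.flip_apply, mulCL_apply, h3, mul_assoc] at h2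
        simp only [h2, neg_mul, smul_mul_assoc]
    _ = _ := integral_neg _

end Cauchy

/-! ### Distributional derivatives and `D_s T h = h` -/

section WeakDerivatives

variable {n : ℕ}

theorem LocallyIntegrableOn.congr_ae_restrict {Ω : Set (Sph n)} {u u' : Sph n → Cl n}
    (hu : LocallyIntegrableOn u Ω (surf n)) (h : u =ᵐ[(surf n).restrict Ω] u') :
    LocallyIntegrableOn u' Ω (surf n) := by
  intro x hx
  obtain ⟨s, hs, hi⟩ := hu x hx
  refine ⟨s ∩ Ω, inter_mem hs self_mem_nhdsWithin, ?_⟩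
  exact (hi.mono_set inter_subset_left).congr_fun_ae
    (ae_restrict_of_ae_restrict_of_subset inter_subset_right h)

/-- The fundamental lemma of the calculus of variations on the sphere. -/
theorem ae_eq_zero_of_integral_test {Ω : Set (Sph n)} (hΩ : IsOpen Ω) {f : Sph n → Cl n}
    (hf : LocallyIntegrableOn f Ω (surf n))
    (h : ∀ ψ, IsTest Ω ψ → ∫ w in Ω, ψ w • f w ∂surf n = 0) :
    f =ᵐ[(surf n).restrict Ω] 0 := by
  have hemb : MeasurableEmbedding (Subtype.val : Sph n → E n) :=
    MeasurableEmbedding.subtype_coe Metric.isClosed_sphere.measurableSet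
  have hmem : ∀ w : Sph n, (w : E n) ∈ cone Ω ↔ w ∈ Ω := fun w => by
    refine ⟨fun hw => ?_, coe_mem_cone⟩
    obtain ⟨h0, h1⟩ := mem_cone_iff.1 hw
    have : radProj (w : E n) h0 = w := Subtype.ext (by simp [radProj])
    rwa [this] at h1
  have hcomp : homExt f ∘ (Subtype.val : Sph n → E n) = f := funext fun w => homExt_coe f w
  -- The Euclidean lemma is applied on the open cone over `Ω`, with the surface measure pushed
  -- forward to `ℝⁿ⁺¹`; test functions on the cone restrict to test functions on `Ω`.
  have key := (isOpen_cone hΩ).ae_eq_zero_of_integral_contDiff_smul_eq_zero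
    (μ := (surf n).map Subtype.val) (f := homExt f) ?_ ?_
  · rw [hemb.ae_map_iff] at key
    rw [EventuallyEq, ae_restrict_iff' hΩ.measurableSet]
    filter_upwards [key] with w hw hwΩ
    have := hw ((hmem w).2 hwΩ)
    rwa [homExt_coe] at this
  · rw [locallyIntegrableOn_iff (isOpen_cone hΩ).isLocallyClosed]
    intro K hK hKc
    rw [hemb.integrableOn_map_iff, hcomp]
    refine hf.integrableOn_compact_subset (fun w hw => (hmem w).1 (hK hw)) ?_
    exact (hKc.isClosed.preimage continuous_subtype_val).isCompact
  · intro g hg hgc hgs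
    rw [hemb.integral_map]
    have htest : IsTest Ω fun w : Sph n => g w := by
      refine ⟨ckOn_restrict fun w _ => hg.contDiffAt, fun w hw => (hmem w).1 (hgs ?_)⟩
      exact tsupport_comp_subset_preimage g continuous_subtype_val hw
    rw [← h _ htest]
    simp only [homExt_coe]
    refine (setIntegral_eq_integral_of_tsupport htest.2 fun w hw => ?_).symm
    rw [image_eq_zero_of_notMem_tsupport (f := fun w : Sph n => g w) hw, zero_smul]

/-- `∑ c_{ab} (x_a ∂_b - x_b ∂_a) u = g` on `Ω` in the sense of distributions. -/
def IsWeakAng (c : Fin (n + 1) → Fin (n + 1) → Cl n) (Ω : Set (Sph n)) (u g : Sph n → Cl n) :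
    Prop :=
  LocallyIntegrableOn u Ω (surf n) ∧ LocallyIntegrableOn g Ω (surf n) ∧
    ∀ ψ : Sph n → ℝ, IsTest Ω ψ → ∫ w in Ω, ψ w • g w ∂surf n =
      -∫ w in Ω, angOp c (fun v => algebraMap ℝ (Cl n) (ψ v)) w * u w ∂surf n

/-- `P (∑ c_{ab} (x_a ∂_b - x_b ∂_a) - n/2) u = g` on `Ω` in the sense of distributions. -/
def IsWeakD (c : Fin (n + 1) → Fin (n + 1) → Cl n) (P : Sph n → Cl n) (Ω : Set (Sph n))
    (u g : Sph n → Cl n) : Prop :=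
  ∃ γ : Sph n → Cl n, IsWeakAng c Ω u γ ∧
    g =ᵐ[(surf n).restrict Ω] fun w => P w * (γ w - ((n : ℝ) / 2) • u w)

theorem isWeakDs_iff {Ω : Set (Sph n)} {u g : Sph n → Cl n} :
    IsWeakDs Ω u g ↔ IsWeakD gamC (fun w => par (w : E n)) Ω u g := by
  simp only [IsWeakDs, IsWeakD, IsWeakGam, IsWeakAng, Gam_eq_angOp]

theorem isWeakDsBar_iff {Ω : Set (Sph n)} {u g : Sph n → Cl n} :
    IsWeakDsBar Ω u g ↔ IsWeakD gamBarC (fun w => parBar (w : E n)) Ω u g := by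
  simp only [IsWeakDsBar, IsWeakD, IsWeakGamBar, IsWeakAng, GamBar_eq_angOp]

variable {c : Fin (n + 1) → Fin (n + 1) → Cl n} {P : Sph n → Cl n} {Ω : Set (Sph n)}
  {u u' g g' : Sph n → Cl n}

theorem IsTest.ckOn_one {ψ : Sph n → ℝ} (hψ : IsTest Ω ψ) : CkOn 1 ψ univ :=
  hψ.1.of_le (by exact_mod_cast le_top)

theorem integrable_mul_of_tsupport {ψ : Sph n → ℝ} (hs : tsupport ψ ⊆ Ω) {k : Sph n → Cl n}
    (hk : Continuous k) (h0 : ∀ w, w ∉ tsupport ψ → k w = 0)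
    (hu : LocallyIntegrableOn u Ω (surf n)) :
    Integrable (fun w => k w * u w) ((surf n).restrict Ω) := by
  obtain ⟨C, hC⟩ := (isCompact_univ (X := Sph n)).exists_bound_of_continuousOn hk.continuousOn
  refine integrable_of_norm_le_of_isCompact hu (isClosed_tsupport ψ).isCompact hs
    ((mulCL n).aestronglyMeasurable_comp₂ hk.aestronglyMeasurable hu.aestronglyMeasurable)
    (‖mulCL n‖ * C) (fun w => (norm_mul_le_mulCL _ _).trans ?_) fun w hw => ?_
  · have := hC w (mem_univ w)
    gcongr
  · rw [h0 w hw, zero_mul]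

theorem IsTest.integrable_angOp_mul {ψ : Sph n → ℝ} (hψ : IsTest Ω ψ)
    (c : Fin (n + 1) → Fin (n + 1) → Cl n) (hu : LocallyIntegrableOn u Ω (surf n)) :
    Integrable (fun w => angOp c (fun v => algebraMap ℝ (Cl n) (ψ v)) w * u w)
      ((surf n).restrict Ω) :=
  integrable_mul_of_tsupport hψ.2 (continuous_angOp_algebraMap c hψ.ckOn_one)
    (fun _ hw => angOp_algebraMap_eq_zero c hψ.ckOn_one hw) hu

theorem IsTest.integrable_smul {ψ : Sph n → ℝ} (hψ : IsTest Ω ψ)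
    (hu : LocallyIntegrableOn u Ω (surf n)) :
    Integrable (fun w => ψ w • u w) ((surf n).restrict Ω) :=
  integrable_smul_of_tsupport hψ.1.continuous hψ.2 hu

theorem IsWeakAng.add_smul (h : IsWeakAng c Ω u g) (h' : IsWeakAng c Ω u' g') (t : ℝ) :
    IsWeakAng c Ω (fun w => u w + t • u' w) (fun w => g w + t • g' w) := by
  refine ⟨h.1.add (h'.1.smul t), h.2.1.add (h'.2.1.smul t), fun ψ hψ => ?_⟩
  simp only [smul_add, mul_add, mul_smul_comm, smul_comm _ t]
  rw [integral_add (hψ.integrable_smul h.2.1) (Integrable.fun_smul t (hψ.integrable_smul h'.2.1)),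
    integral_add (hψ.integrable_angOp_mul c h.1)
      (Integrable.fun_smul t (hψ.integrable_angOp_mul c h'.1)),
    integral_smul, integral_smul, h.2.2 ψ hψ, h'.2.2 ψ hψ, smul_neg, neg_add]

theorem IsWeakAng.congr (h : IsWeakAng c Ω u g) (hu : u =ᵐ[(surf n).restrict Ω] u') :
    IsWeakAng c Ω u' g := by
  refine ⟨LocallyIntegrableOn.congr_ae_restrict h.1 hu, h.2.1, fun ψ hψ => ?_⟩
  rw [h.2.2 ψ hψ]
  congr 1
  refine integral_congr_ae ?_
  filter_upwards [hu] with w hw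
  rw [hw]

theorem IsWeakAng.unique (hΩ : IsOpen Ω) (h : IsWeakAng c Ω u g) (h' : IsWeakAng c Ω u g') :
    g =ᵐ[(surf n).restrict Ω] g' := by
  have := ae_eq_zero_of_integral_test hΩ (h.2.1.sub h'.2.1) fun ψ hψ => by
    simp only [Pi.sub_apply, smul_sub]
    rw [integral_sub (hψ.integrable_smul h.2.1) (hψ.integrable_smul h'.2.1), h.2.2 ψ hψ,
      h'.2.2 ψ hψ, sub_self]
  filter_upwards [this] with w hw
  exact sub_eq_zero.1 hw

theorem isWeakAng_of_ckOn (hΩ : IsOpen Ω) (hu : CkOn 1 u Ω) :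
    IsWeakAng c Ω u (angOp c u) := by
  refine ⟨hu.continuousOn.locallyIntegrableOn hΩ.measurableSet,
    ContinuousOn.locallyIntegrableOn ?_ hΩ.measurableSet,
    fun ψ hψ => integral_smul_angOp c hΩ hψ.ckOn_one hψ.2 hu⟩
  exact continuousOn_finsetSum _ fun a _ => continuousOn_finsetSum _ fun b _ =>
    continuousOn_const.mul (hu.continuousOn_rotDeriv hΩ a b)

theorem IsWeakD.add_smul (h : IsWeakD c P Ω u g) (h' : IsWeakD c P Ω u' g') (t : ℝ) :
    IsWeakD c P Ω (fun w => u w + t • u' w) (fun w => g w + t • g' w) := by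
  obtain ⟨γ, hγ, hg⟩ := h
  obtain ⟨γ', hγ', hg'⟩ := h'
  refine ⟨_, hγ.add_smul hγ' t, ?_⟩
  filter_upwards [hg, hg'] with w hw hw'
  rw [hw, hw', ← mul_smul_comm, ← mul_add]
  congr 1
  module

theorem IsWeakD.add (h : IsWeakD c P Ω u g) (h' : IsWeakD c P Ω u' g') :
    IsWeakD c P Ω (u + u') (g + g') := by
  have := h.add_smul h' 1
  simp only [one_smul] at this
  exact this

theorem IsWeakD.sub (h : IsWeakD c P Ω u g) (h' : IsWeakD c P Ω u' g') :
    IsWeakD c P Ω (u - u') (g - g') := by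
  have := h.add_smul h' (-1)
  simp only [neg_smul, one_smul, ← sub_eq_add_neg] at this
  exact this

theorem IsWeakD.congr (h : IsWeakD c P Ω u g) (hu : u =ᵐ[(surf n).restrict Ω] u')
    (hg : g =ᵐ[(surf n).restrict Ω] g') : IsWeakD c P Ω u' g' := by
  obtain ⟨γ, hγ, hg1⟩ := h
  refine ⟨γ, hγ.congr hu, ?_⟩
  filter_upwards [hg, hg1, hu] with w h1 h2 h3
  rw [← h1, h2, h3]

theorem IsWeakD.unique (hΩ : IsOpen Ω) (h : IsWeakD c P Ω u g) (h' : IsWeakD c P Ω u g') :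
    g =ᵐ[(surf n).restrict Ω] g' := by
  obtain ⟨γ, hγ, hg⟩ := h
  obtain ⟨γ', hγ', hg'⟩ := h'
  filter_upwards [hγ.unique hΩ hγ', hg, hg'] with w h1 h2 h3
  rw [h2, h3, h1]

theorem isWeakD_of_ckOn (hΩ : IsOpen Ω) (hu : CkOn 1 u Ω) :
    IsWeakD c P Ω u fun w => P w * (angOp c u w - ((n : ℝ) / 2) • u w) :=
  ⟨_, isWeakAng_of_ckOn hΩ hu, EventuallyEq.rfl⟩

/-- `D_s T h = h`. -/
theorem isWeakDs_T (hn : 1 ≤ n) {h : Sph n → Cl n} (hh : Integrable h ((surf n).restrict Ω)) :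
    IsWeakD gamC (fun w => par (w : E n)) Ω (T Ω h) h := by
  have hT : LocallyIntegrableOn (T Ω h) Ω (surf n) :=
    IntegrableOn.locallyIntegrableOn (integrable_T hn hh)
  obtain ⟨C, hC⟩ := (isCompact_univ (X := Sph n)).exists_bound_of_continuousOn
    (continuous_parBar.comp (continuous_subtype_val (p := (· ∈ Metric.sphere (0 : E n) 1)))).continuousOn
  have hb : Integrable (fun w : Sph n => parBar (w : E n) * h w) ((surf n).restrict Ω) := by
    refine Integrable.mono' (hh.norm.const_mul (‖mulCL n‖ * C))
      ((mulCL n).aestronglyMeasurable_comp₂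
        (continuous_parBar.comp continuous_subtype_val).aestronglyMeasurable hh.1)
      (ae_of_all _ fun w => (norm_mul_le_mulCL _ _).trans ?_)
    have := hC w (mem_univ w)
    simp only [Function.comp_apply] at this
    gcongr
  have hbl : LocallyIntegrableOn (fun w : Sph n => parBar (w : E n) * h w) Ω (surf n) :=
    IntegrableOn.locallyIntegrableOn hb
  have hTs : LocallyIntegrableOn (fun w => ((n : ℝ) / 2) • T Ω h w) Ω (surf n) :=
    hT.smul ((n : ℝ) / 2)
  -- The value of `Γ₀ T h` is forced: `w (γ - (n/2) T h) = h` and `w̄ w = 1` leave only `γ = w̄ h +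
  -- (n/2) T h`.
  refine ⟨fun w => parBar (w : E n) * h w + ((n : ℝ) / 2) • T Ω h w,
    ⟨hT, hbl.add hTs, fun ψ hψ => ?_⟩, ae_of_all _ fun w => ?_⟩
  · have h1 := setIntegral_testOp_mul_T hn hh hψ.ckOn_one hψ.2
    have h2 : ∀ w, testOp ψ w * T Ω h w =
        angOp gamC (fun v => algebraMap ℝ (Cl n) (ψ v)) w * T Ω h w +
          ((n : ℝ) / 2) • (ψ w • T Ω h w) := fun w => by
      rw [testOp, add_mul, smul_mul_assoc, one_mul, mul_smul]
    simp only [h2] at h1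
    have h3 := Integrable.fun_smul ((n : ℝ) / 2) (hψ.integrable_smul hT)
    rw [integral_add (hψ.integrable_angOp_mul _ hT) h3, eq_neg_iff_add_eq_zero] at h1
    simp only [smul_add, smul_comm _ ((n : ℝ) / 2)]
    rw [integral_add (hψ.integrable_smul hbl) h3, eq_neg_iff_add_eq_zero, ← h1]
    abel
  · simp only [add_sub_cancel_right]
    rw [← mul_assoc, par_mul_parBar_sphere, one_mul]

end WeakDerivatives

/-! ### The integral equation, its contraction, and the Beltrami equation -/

section Beltrami

variable {n : ℕ} {Ω : Set (Sph n)} {m : Sph n → Cl n} {p : ℝ≥0∞}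

/-- `(D̄_s + m) T h = g` on `Ω`. -/
def IsPi (m : Sph n → Cl n) (Ω : Set (Sph n)) (h g : Sph n → Cl n) : Prop :=
  ∃ k : Sph n → Cl n, IsWeakDsBar Ω (T Ω h) k ∧
    g =ᵐ[(surf n).restrict Ω] fun w => k w + m w * T Ω h w

/-- `D_s f = q (D̄_s + m) f` on `Ω` in the sense of distributions. -/
def SolvesBeltrami (m : Sph n → Cl n) (Ω : Set (Sph n)) (q f : Sph n → Cl n) : Prop :=
  ∃ g k : Sph n → Cl n, IsWeakDs Ω f g ∧ IsWeakDsBar Ω f k ∧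
    g =ᵐ[(surf n).restrict Ω] fun w => q w * (k w + m w * f w)

/-- `h = q ((D̄_s + m) φ + (D̄_s + m) T h)` on `Ω`. -/
def SolvesIntegral (m : Sph n → Cl n) (Ω : Set (Sph n)) (q φ h : Sph n → Cl n) : Prop :=
  ∃ g : Sph n → Cl n, IsPi m Ω h g ∧
    h =ᵐ[(surf n).restrict Ω] fun w => q w * (DsBar φ w + m w * φ w + g w)

theorem IsPi.sub (hn : 1 ≤ n) {h h' g g' : Sph n → Cl n} (H : IsPi m Ω h g) (H' : IsPi m Ω h' g')
    (hh : Integrable h ((surf n).restrict Ω)) (hh' : Integrable h' ((surf n).restrict Ω)) :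
    IsPi m Ω (h - h') (g - g') := by
  obtain ⟨k, hk, hg⟩ := H
  obtain ⟨k', hk', hg'⟩ := H'
  rw [isWeakDsBar_iff] at hk hk'
  have hT := T_sub hn hh hh'
  refine ⟨k - k', isWeakDsBar_iff.2 ((hk.sub hk').congr hT.symm EventuallyEq.rfl), ?_⟩
  filter_upwards [hg, hg', hT] with w h1 h2 h3
  simp only [Pi.sub_apply] at h3 ⊢
  rw [h1, h2, h3, mul_sub]
  abel

theorem IsPi.unique (hΩ : IsOpen Ω) {h h' g g' : Sph n → Cl n} (H : IsPi m Ω h g)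
    (H' : IsPi m Ω h' g') (hh : h =ᵐ[(surf n).restrict Ω] h') :
    g =ᵐ[(surf n).restrict Ω] g' := by
  obtain ⟨k, hk, hg⟩ := H
  obtain ⟨k', hk', hg'⟩ := H'
  rw [← T_congr hh] at hk' hg'
  rw [isWeakDsBar_iff] at hk hk'
  filter_upwards [hk.unique hΩ hk', hg, hg'] with w h1 h2 h3
  rw [h2, h3, h1]

theorem eLpNorm_mul_le {μ : Measure (Sph n)} {q : Sph n → Cl n} {q₀ : ℝ≥0}
    (hq₀ : multNorm μ q ≤ q₀) (g : Sph n → Cl n) :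
    eLpNorm (fun w => q w * g w) p μ ≤ q₀ * eLpNorm g p μ := by
  have h1 : ∀ᵐ w ∂μ, ‖LinearMap.toContinuousLinearMap (LinearMap.mulLeft ℝ (q w))‖ₑ ≤ q₀ := by
    filter_upwards [ENNReal.ae_le_essSup
      fun w => ‖LinearMap.toContinuousLinearMap (LinearMap.mulLeft ℝ (q w))‖ₑ] with w hw
    exact hw.trans hq₀
  have h2 : ∀ᵐ w ∂μ, ‖q w * g w‖ₑ ≤ q₀ * ‖g w‖ₑ := by
    filter_upwards [h1] with w hw
    refine ((LinearMap.toContinuousLinearMap (LinearMap.mulLeft ℝ (q w))).le_opENorm (g w)).trans ?_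
    gcongr
  exact eLpNorm_le_nnreal_smul_eLpNorm_of_ae_le_mul' h2 p

theorem MemLp.clifford_mul {μ : Measure (Sph n)} {q : Sph n → Cl n} {q₀ : ℝ≥0}
    (hq : AEStronglyMeasurable q μ) (hq₀ : multNorm μ q ≤ q₀) {g : Sph n → Cl n}
    (hg : MemLp g p μ) : MemLp (fun w => q w * g w) p μ :=
  ⟨(mulCL n).aestronglyMeasurable_comp₂ hq hg.1,
    (eLpNorm_mul_le hq₀ g).trans_lt (ENNReal.mul_lt_top ENNReal.coe_lt_top hg.2)⟩

/-- The infimum defining `piNorm` need not be known to be attained; the strict inequality leaves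
room for an admissible `C` with `q₀ C < 1`. An infinite norm is excluded, since `1 / ∞ = 0`. -/
theorem exists_bound_of_lt_inv_piNorm {q₀ : ℝ≥0} {R : (Sph n → Cl n) → (Sph n → Cl n) → Prop}
    (h : (q₀ : ℝ≥0∞) < 1 / piNorm Ω p R) :
    ∃ C : ℝ≥0∞, q₀ * C < 1 ∧ ∀ h : Sph n → Cl n, MemLp h p ((surf n).restrict Ω) →
      ∃ g : Sph n → Cl n, R h g ∧ MemLp g p ((surf n).restrict Ω) ∧
        eLpNorm g p ((surf n).restrict Ω) ≤ C * eLpNorm h p ((surf n).restrict Ω) := by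
  rw [one_div, ENNReal.lt_inv_iff_lt_inv, piNorm, sInf_lt_iff] at h
  obtain ⟨C, hC, hlt⟩ := h
  refine ⟨C, ?_, hC⟩
  rcases eq_or_ne q₀ 0 with rfl | h0
  · simp
  · have h1 : (q₀ : ℝ≥0∞) ≠ 0 := by simpa using h0
    rw [mul_comm]
    exact (ENNReal.lt_div_iff_mul_lt (Or.inl h1) (Or.inl ENNReal.coe_ne_top)).1
      (by rwa [one_div])

theorem eq_zero_of_le_mul_of_lt_one {x r : ℝ≥0∞} (hr : r < 1) (hx : x ≠ ⊤) (h : x ≤ r * x) :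
    x = 0 := by
  by_contra h0
  have := ENNReal.mul_lt_mul_left h0 hx hr
  rw [one_mul] at this
  exact absurd h (not_le.2 this)

/-- A contraction argument for the equation `h = q (a + Π h)` in `L^p`. -/
theorem exists_unique_integral_equation {μ : Measure (Sph n)} (hp : 1 ≤ p)
    {R : (Sph n → Cl n) → (Sph n → Cl n) → Prop}
    (hsub : ∀ {h h' g g'}, MemLp h p μ → MemLp h' p μ → R h g → R h' g' → R (h - h') (g - g'))
    (hunique : ∀ {h h' g g'}, R h g → R h' g' → h =ᵐ[μ] h' → g =ᵐ[μ] g')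
    {q : Sph n → Cl n} {q₀ : ℝ≥0} (hq : AEStronglyMeasurable q μ) (hq₀ : multNorm μ q ≤ q₀)
    {C : ℝ≥0∞} (hC : q₀ * C < 1)
    (hR : ∀ h : Sph n → Cl n, MemLp h p μ →
      ∃ g : Sph n → Cl n, R h g ∧ MemLp g p μ ∧ eLpNorm g p μ ≤ C * eLpNorm h p μ)
    {a : Sph n → Cl n} (ha : MemLp a p μ) :
    ∃ h : Sph n → Cl n, MemLp h p μ ∧ (∃ g, R h g ∧ h =ᵐ[μ] fun w => q w * (a w + g w)) ∧
      ∀ h' : Sph n → Cl n, MemLp h' p μ → (∃ g, R h' g ∧ h' =ᵐ[μ] fun w => q w * (a w + g w)) →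
        h' =ᵐ[μ] h := by
  -- The norm bound is known for some image of `h - h'` only; uniqueness up to null sets transfers
  -- it to `g - g'`. Hence the choice of images made below is harmless.
  have hbound : ∀ {h h' g g'}, MemLp h p μ → MemLp h' p μ → R h g → R h' g' →
      eLpNorm ((fun w => q w * (a w + g w)) - fun w => q w * (a w + g' w)) p μ ≤
        q₀ * C * eLpNorm (h - h') p μ := by
    intro h h' g g' hh hh' hg hg'
    obtain ⟨g₀, hg₀, -, hle⟩ := hR _ (hh.sub hh')
    have h1 : ((fun w => q w * (a w + g w)) - fun w => q w * (a w + g' w)) =ᵐ[μ]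
        fun w => q w * g₀ w := by
      filter_upwards [hunique (hsub hh hh' hg hg') hg₀ EventuallyEq.rfl] with w hw
      rw [← hw, Pi.sub_apply, Pi.sub_apply, ← mul_sub, add_sub_add_left_eq_sub]
    rw [eLpNorm_congr_ae h1, mul_assoc]
    exact (eLpNorm_mul_le hq₀ g₀).trans (by gcongr)
  have : Fact (1 ≤ p) := ⟨hp⟩
  choose G hG hGm _ using hR
  have hmem : ∀ F : Lp (Cl n) p μ, MemLp (fun w => q w * (a w + G F (Lp.memLp F) w)) p μ :=
    fun F => MemLp.clifford_mul hq hq₀ (ha.add (hGm F (Lp.memLp F)))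
  set Φ : Lp (Cl n) p μ → Lp (Cl n) p μ := fun F => (hmem F).toLp _ with hΦ
  have hcontr : ContractingWith (q₀ * C).toNNReal Φ := by
    constructor
    · rw [← ENNReal.coe_lt_coe, ENNReal.coe_toNNReal hC.ne_top]
      exact hC
    · intro F F'
      rw [ENNReal.coe_toNNReal hC.ne_top, hΦ, Lp.edist_toLp_toLp, Lp.edist_def]
      exact hbound (Lp.memLp F) (Lp.memLp F') (hG _ _) (hG _ _)
  set F := hcontr.fixedPoint Φ with hF
  have hfix : Φ F = F := hcontr.fixedPoint_isFixedPt
  have hFeq : F =ᵐ[μ] fun w => q w * (a w + G F (Lp.memLp F) w) := by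
    have := (hmem F).coeFn_toLp
    change (Φ F : Sph n → Cl n) =ᵐ[μ] _ at this
    rwa [hfix] at this
  refine ⟨F, Lp.memLp F, ⟨_, hG F (Lp.memLp F), hFeq⟩, fun h' hh' ⟨g', hg', heq'⟩ => ?_⟩
  -- The same estimate, applied to two solutions, bounds the finite norm of their difference by `q₀
  -- C < 1` times itself.
  have hle := hbound hh' (Lp.memLp F) hg' (hG F (Lp.memLp F))
  rw [← eLpNorm_congr_ae (heq'.sub hFeq)] at hle
  have h0 := eq_zero_of_le_mul_of_lt_one hC (hh'.sub (Lp.memLp F)).2.ne hle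
  rw [eLpNorm_eq_zero_iff (hh'.sub (Lp.memLp F)).1 (by positivity)] at h0
  filter_upwards [h0] with w hw
  exact sub_eq_zero.1 hw

theorem LeftMonogenic.isWeakDs (hΩ : IsOpen Ω) {φ : Sph n → Cl n} (hφ : LeftMonogenic Ω φ) :
    IsWeakD gamC (fun w => par (w : E n)) Ω φ 0 := by
  refine (isWeakD_of_ckOn hΩ hφ.1).congr EventuallyEq.rfl ?_
  filter_upwards [ae_restrict_mem hΩ.measurableSet] with w hw
  have := hφ.2 w hw
  rwa [Ds, Gam_eq_angOp] at this

theorem LeftMonogenic.isWeakDsBar (hΩ : IsOpen Ω) {φ : Sph n → Cl n} (hφ : LeftMonogenic Ω φ) :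
    IsWeakD gamBarC (fun w => parBar (w : E n)) Ω φ (DsBar φ) := by
  have := isWeakD_of_ckOn (c := gamBarC) (P := fun w => parBar (w : E n)) hΩ hφ.1
  rw [← GamBar_eq_angOp] at this
  exact this

/-- The Beltrami equation for `φ + T h` is equivalent to the integral equation for `h`. -/
theorem solvesBeltrami_iff (hn : 1 ≤ n) (hΩ : IsOpen Ω) {φ : Sph n → Cl n}
    (hφ : LeftMonogenic Ω φ) {q h : Sph n → Cl n} (hh : Integrable h ((surf n).restrict Ω)) :
    SolvesBeltrami m Ω q (φ + T Ω h) ↔ SolvesIntegral m Ω q φ h := by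
  have h1 : IsWeakD gamC (fun w => par (w : E n)) Ω (φ + T Ω h) h := by
    simpa using (hφ.isWeakDs hΩ).add (isWeakDs_T hn hh)
  have h2 := hφ.isWeakDsBar hΩ
  constructor
  · rintro ⟨g, k, hg, hk, heq⟩
    rw [isWeakDs_iff] at hg
    rw [isWeakDsBar_iff] at hk
    -- As `D̄_s φ` is classical, the weak derivative `k` of the sum leaves `k - D̄_s φ` for `D̄_s T
    -- h`.
    refine ⟨fun w => (k - DsBar φ) w + m w * T Ω h w, ⟨k - DsBar φ, ?_, EventuallyEq.rfl⟩, ?_⟩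
    · rw [isWeakDsBar_iff]
      simpa using hk.sub h2
    · filter_upwards [hg.unique hΩ h1, heq] with w h3 h4
      rw [← h3, h4, Pi.sub_apply, Pi.add_apply, mul_add (m w)]
      congr 1
      abel
  · rintro ⟨g, ⟨k, hk, hg⟩, heq⟩
    rw [isWeakDsBar_iff] at hk
    refine ⟨h, DsBar φ + k, isWeakDs_iff.2 h1, isWeakDsBar_iff.2 (h2.add hk), ?_⟩
    filter_upwards [heq, hg] with w h3 h4
    rw [h3, h4, Pi.add_apply, Pi.add_apply, mul_add (m w)]
    congr 1
    abel

/-- The common form of both parts. The sphere has finite measure, so `L^p` functions are integrable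
and the results on `T` apply to them. -/
theorem beltrami (hn : 1 ≤ n) (hΩ : IsOpen Ω) (hp : 1 ≤ p) {q : Sph n → Cl n}
    (hq : AEStronglyMeasurable q ((surf n).restrict Ω)) {q₀ : ℝ≥0}
    (hq₀ : multNorm ((surf n).restrict Ω) q ≤ q₀) {φ : Sph n → Cl n} (hφ : LeftMonogenic Ω φ)
    (hlt : (q₀ : ℝ≥0∞) < 1 / piNorm Ω p (IsPi m Ω))
    (ha : MemLp (fun w => DsBar φ w + m w * φ w) p ((surf n).restrict Ω)) :
    ∃ h : Sph n → Cl n, MemLp h p ((surf n).restrict Ω) ∧ SolvesIntegral m Ω q φ h ∧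
      SolvesBeltrami m Ω q (φ + T Ω h) ∧
      (∀ h' : Sph n → Cl n, MemLp h' p ((surf n).restrict Ω) → SolvesIntegral m Ω q φ h' →
        h' =ᵐ[(surf n).restrict Ω] h) ∧
      (∀ h' : Sph n → Cl n, MemLp h' p ((surf n).restrict Ω) →
        SolvesBeltrami m Ω q (φ + T Ω h') → h' =ᵐ[(surf n).restrict Ω] h) := by
  obtain ⟨C, hC, hR⟩ := exists_bound_of_lt_inv_piNorm hlt
  obtain ⟨h, hh, hsol, huniq⟩ := exists_unique_integral_equation hp
    (fun hh hh' H H' => H.sub hn H' (hh.integrable hp) (hh'.integrable hp))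
    (fun H H' hh => H.unique hΩ H' hh) hq hq₀ hC hR ha
  refine ⟨h, hh, hsol, (solvesBeltrami_iff hn hΩ hφ (hh.integrable hp)).2 hsol, huniq,
    fun h' hh' hB => huniq h' hh' ((solvesBeltrami_iff hn hΩ hφ (hh'.integrable hp)).1 hB)⟩

/-- The left side allows changing the image on a null set; the right side is invariant under such
changes. -/
theorem isPi_zero : IsPi (0 : Sph n → Cl n) Ω = IsPi1 Ω := by
  funext h g
  simp only [IsPi, IsPi1, Pi.zero_apply, zero_mul, add_zero, eq_iff_iff]
  constructor
  · rintro ⟨k, hk, hg⟩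
    rw [isWeakDsBar_iff] at hk ⊢
    exact hk.congr EventuallyEq.rfl hg.symm
  · exact fun H => ⟨g, H, EventuallyEq.rfl⟩

end Beltrami
end SphBeltrami

end

theorem mainTheorem6 (n : ℕ) (hn : 1 ≤ n) (Ω : Set (Sph n)) (hΩ : IsOpen Ω)
    (p : ℝ≥0∞) (hp : 1 < p) (hp' : p ≠ ⊤)
    (q : Sph n → Cl n)
    (hq : AEStronglyMeasurable q ((surf n).restrict Ω)) (q₀ : ℝ≥0)
    (hq₀ : multNorm ((surf n).restrict Ω) q ≤ q₀)
    (φ : Sph n → Cl n) (hφ : LeftMonogenic Ω φ) :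
    -- the equation `D_s f = q (D̄_s + w̄) f`
    ((q₀ : ℝ≥0∞) < 1 / piNorm Ω p (IsPi0 Ω) →
      MemLp (fun w => DsBar φ w + parBar (w : E n) * φ w) p
        ((surf n).restrict Ω) →
      ∃ h : Sph n → Cl n,
        MemLp h p ((surf n).restrict Ω) ∧
        SolvesIntegral0 Ω q φ h ∧
        SolvesBeltrami0 Ω q (φ + T Ω h) ∧
        (∀ h' : Sph n → Cl n,
          MemLp h' p ((surf n).restrict Ω) →
          SolvesIntegral0 Ω q φ h' →
          h' =ᵐ[(surf n).restrict Ω] h) ∧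
        (∀ h' : Sph n → Cl n,
          MemLp h' p ((surf n).restrict Ω) →
          SolvesBeltrami0 Ω q (φ + T Ω h') →
          h' =ᵐ[(surf n).restrict Ω] h)) ∧
    -- the equation `D_s f = q D̄_s f`
    ((q₀ : ℝ≥0∞) < 1 / piNorm Ω p (IsPi1 Ω) →
      MemLp (DsBar φ) p ((surf n).restrict Ω) →
      ∃ h : Sph n → Cl n,
        MemLp h p ((surf n).restrict Ω) ∧
        SolvesIntegral1 Ω q φ h ∧
        SolvesBeltrami1 Ω q (φ + T Ω h) ∧
        (∀ h' : Sph n → Cl n,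
          MemLp h' p ((surf n).restrict Ω) →
          SolvesIntegral1 Ω q φ h' →
          h' =ᵐ[(surf n).restrict Ω] h) ∧
        (∀ h' : Sph n → Cl n,
          MemLp h' p ((surf n).restrict Ω) →
          SolvesBeltrami1 Ω q (φ + T Ω h') →
          h' =ᵐ[(surf n).restrict Ω] h)) := by
  -- For `m = w̄` the general predicates unfold to those of the first equation; the second is `m =
  -- 0`.
  refine ⟨fun hlt ha => beltrami hn hΩ hp.le hq hq₀ hφ hlt ha, fun hlt ha => ?_⟩
  rw [← isPi_zero] at hlt
  have := beltrami hn hΩ hp.le hq hq₀ hφ hlt (by simpa using ha)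
  simp only [SolvesIntegral, SolvesBeltrami, isPi_zero, Pi.zero_apply, zero_mul, add_zero] at this
  exact this
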